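/- Let $\gamma>0$ and let $V:(\mathbb{R}/\mathbb{Z})^2\to\mathbb{R}$ be piecewise $\gamma$-Hölder continuous with respect to the second variable, that is, $V$ is measurable and there are $0=a_1<a_2<\cdots<a_m=1$ such that $$\sup_{(x,y)}|V(x,y)|+\sup_{x\in\mathbb{R}/\mathbb{Z}}\ \sup_{1\le i\le m-1}\ \sup_{y_1\ne y_2\in[a_i,a_{i+1}]}\frac{|V(x,y_1)-V(x,y_2)|}{|y_1-y_2|^{\gamma}}<\infty .$$ Let $\omega\in\mathbb{R}$ and consider on $L^2(\mathbb{R})$ the Schrödinger operator $$(Hu)(x)=-u''(x)+V(x,\omega x)\,u(x).$$ For $\theta\in\mathbb{R}/\mathbb{Z}$ and $E\in\mathbb{R}$ let $T_\theta(E,y,x)$ be the transfer matrix of the equation $-u''(x)+V(x,\theta+\omega x)u(x)=Eu(x)$, that is, the $2\times2$ matrix that maps $(u'(y),u(y))^{T}$ to $(u'(x),u(x))^{T}$ for every solution $u$ (solutions are differentiable with locally absolutely continuous derivative and satisfy the equation almost everywhere), and let $$L(E)=\lim_{x\to\infty}\frac1x\int_{\mathbb{R}/\mathbb{Z}}\ln\|T_\theta(E,0,x)\|\,d\theta$$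 be the Lyapunov exponent. Let $$\beta(\omega)=\limsup_{k\to\infty}\frac{-\ln\|k\omega\|}{k}\in[0,\infty],$$ where $\|t\|=\operatorname{dist}(t,\mathbb{Z})$ and $-\ln 0=+\infty$. Then $H$ has no eigenvalue in $\{E\in\mathbb{R}: L(E)<\gamma\beta(\omega)\}$: if $E$ is in this set, then there is no nonzero $u\in L^2(\mathbb{R})$, differentiable with locally absolutely continuous derivative, such that $Hu=Eu$ almost everywhere. -/

import Mathlib

open MeasureTheory Filter Topology
open scoped Matrix.Norms.L2Operator

noncomputable section

/-- The class `A_γ`: measurable functions on the two-torus that are bounded and, on each of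
finitely many closed intervals `[a_i, a_{i+1}]` partitioning `[0, 1]`, `γ`-Hölder continuous in the
second variable, uniformly in the first. -/
def PiecewiseHolder (γ : ℝ) (V : UnitAddCircle × UnitAddCircle → ℝ) : Prop :=
  Measurable V ∧
    ∃ (n : ℕ) (a : Fin (n + 1) → ℝ), StrictMono a ∧ a 0 = 0 ∧ a (Fin.last n) = 1 ∧
      ∃ C : ℝ, (∀ p, |V p| ≤ C) ∧
        ∀ (x : UnitAddCircle) (i : Fin n),
          ∀ y₁ ∈ Set.Icc (a i.castSucc) (a i.succ), ∀ y₂ ∈ Set.Icc (a i.castSucc) (a i.succ),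
            |V (x, (y₁ : UnitAddCircle)) - V (x, (y₂ : UnitAddCircle))| ≤ C * |y₁ - y₂| ^ γ

/-- The potential `t ↦ V (t, θ + ω t)` on the line, with phase `θ`. -/
def quasiPotential (V : UnitAddCircle × UnitAddCircle → ℝ) (ω : ℝ) (θ : UnitAddCircle) (t : ℝ) :
    ℝ :=
  V ((t : UnitAddCircle), θ + ((ω * t : ℝ) : UnitAddCircle))

/-- `u` solves `-u'' + W u = E u` on the line: `u` is differentiable, `u'` is locally absolutely
continuous, and the equation holds almost everywhere. -/
structure IsSolution {𝕜 : Type} [RCLike 𝕜] (W : ℝ → ℝ) (E : ℝ) (u : ℝ → 𝕜) : Prop where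
  differentiable : Differentiable ℝ u
  deriv_ac : ∀ a b : ℝ, AbsolutelyContinuousOnInterval (deriv u) a b
  equation : ∀ᵐ x : ℝ, -deriv (deriv u) x + (W x : 𝕜) * u x = (E : 𝕜) * u x

/-- `E` is an eigenvalue of the Schrödinger operator `-d²/dx² + W` on `L²(ℝ)`. -/
def IsSchrodingerEigenvalue (W : ℝ → ℝ) (E : ℝ) : Prop :=
  ∃ u : ℝ → ℂ, IsSolution W E u ∧ MemLp u 2 volume ∧ u ≠ 0

/-- `T` maps the data `(u'(y), u(y))` of every solution to the data `(u'(x), u(x))`. -/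
def IsTransferMatrix (W : ℝ → ℝ) (E y x : ℝ) (T : Matrix (Fin 2) (Fin 2) ℝ) : Prop :=
  ∀ u : ℝ → ℝ, IsSolution W E u → T.mulVec ![deriv u y, u y] = ![deriv u x, u x]

/-- The transfer matrix `T(E, y, x)`. For bounded measurable `W` there is exactly one matrix with
the property `IsTransferMatrix`. -/
def transferMatrix (W : ℝ → ℝ) (E y x : ℝ) : Matrix (Fin 2) (Fin 2) ℝ :=
  Classical.epsilon (IsTransferMatrix W E y x)

/-- The Lyapunov exponent
`L(E) = lim_{x → ∞} (1 / x) ∫ log ‖T_θ(E, 0, x)‖ dθ`, where `T_θ` is the transfer matrix for the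
potential with phase `θ` (operator norm for the Euclidean norm). -/
def lyapunovExponent (V : UnitAddCircle × UnitAddCircle → ℝ) (ω E : ℝ) : ℝ :=
  limUnder atTop fun x : ℝ =>
    (1 / x) * ∫ θ : UnitAddCircle, Real.log ‖transferMatrix (quasiPotential V ω θ) E 0 x‖

/-- `β(ω) = limsup_{k → ∞} -log ‖k ω‖ / k`, where `‖·‖` is the distance to the nearest integer, as
an extended real, with `log 0 = -∞`. -/
def liouvilleExponent (ω : ℝ) : EReal :=
  limsup (fun k : ℕ =>
    -ENNReal.log (ENNReal.ofReal ‖((k * ω : ℝ) : UnitAddCircle)‖) / ((k : ℝ) : EReal)) atTop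

end

/-!
The proof is Gordon's argument. Gluing the Hölder pieces, `V` is `γ`-Hölder on the whole circle in
its second variable. Choose `L(E) < L' < γ b` with `b < β(ω)`, so that `‖k ω‖ < exp (-b k)` for
infinitely many `k`; then shifting by `k` changes the potential by at most a constant times
`exp (-γ b k)`. Unique ergodicity of the irrational rotation makes the upper bound
`‖T_θ(E, 0, n)‖ ≤ exp (K + L' n)` uniform in `θ`, so a telescoping sum over unit steps shows that
the transfer matrices over `[-k, 0]`, `[0, k]` and `[k, 2 k]` differ by at most a constant times
`k exp ((L' - γ b) k)`, which tends to zero. For three equal blocks `A` of determinant one,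
Cayley–Hamilton reads `A² + 1 = (tr A) A`, and this prevents a nonzero solution from being small at
`-k`, `k` and `2 k` simultaneously. But the Cauchy data of a square integrable solution tend to
zero at infinity. For rational `ω` the potential is periodic and the blocks agree exactly.
-/

section LinearSystems

theorem le_mul_exp_of_le_add_integral {φ : ℝ → ℝ} (hφ : Continuous φ) (h0 : ∀ y, 0 ≤ φ y)
    {K η a x : ℝ} (hK : 0 ≤ K) (hax : a ≤ x)
    (h : ∀ y ∈ Set.Icc a x, φ y ≤ η + K * ∫ t in a..y, φ t) :
    φ x ≤ η * Real.exp (K * (x - a)) := by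
  have hd (y : ℝ) : HasDerivAt (fun z => ∫ t in a..z, φ t) (φ y) y :=
    hφ.integral_hasStrictDerivAt a y |>.hasDerivAt
  have hnn : ∀ y ∈ Set.Icc a x, 0 ≤ ∫ t in a..y, φ t := fun y hy =>
    intervalIntegral.integral_nonneg hy.1 fun t _ => h0 t
  have hprim : ∫ t in a..x, φ t ≤ gronwallBound 0 K η (x - a) := by
    refine (le_abs_self _).trans <| norm_le_gronwallBound_of_norm_deriv_right_le (f' := φ)
      (fun y _ => (hd y).continuousAt.continuousWithinAt) (fun y _ => (hd y).hasDerivWithinAt)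
      (by simp) (fun y hy => ?_) x (Set.right_mem_Icc.2 hax)
    have hy' := Set.Ico_subset_Icc_self hy
    rw [Real.norm_of_nonneg (h0 y), Real.norm_of_nonneg (hnn y hy')]
    linarith [h y hy']
  calc φ x ≤ η + K * gronwallBound 0 K η (x - a) :=
        (h x (Set.right_mem_Icc.2 hax)).trans (by gcongr)
    _ = η * Real.exp (K * (x - a)) := by
        rcases hK.eq_or_lt with rfl | hK
        · rw [zero_mul, zero_mul, Real.exp_zero, mul_one, add_zero]
        · rw [gronwallBound_of_K_ne_0 hK.ne']
          field_simp
          ring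

theorem le_mul_exp_of_le_add_abs_integral {φ : ℝ → ℝ} (hφ : Continuous φ) (h0 : ∀ y, 0 ≤ φ y)
    {K η a x : ℝ} (hK : 0 ≤ K)
    (h : ∀ y ∈ Set.uIcc a x, φ y ≤ η + K * |∫ t in a..y, φ t|) :
    φ x ≤ η * Real.exp (K * |x - a|) := by
  rcases le_total a x with hax | hxa
  · rw [abs_of_nonneg (sub_nonneg.2 hax)]
    refine le_mul_exp_of_le_add_integral hφ h0 hK hax fun y hy => ?_
    rw [← abs_of_nonneg (intervalIntegral.integral_nonneg hy.1 fun t _ => h0 t)]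
    exact h y (Set.Icc_subset_uIcc hy)
  · have key := le_mul_exp_of_le_add_integral (φ := fun t => φ (-t)) (hφ.comp continuous_neg)
      (fun y => h0 (-y)) hK (neg_le_neg hxa) (η := η) fun y hy => by
        have hsymm : ∫ t in (-a)..y, φ (-t) = -∫ t in a..(-y), φ t := by
          rw [intervalIntegral.integral_comp_neg, neg_neg, intervalIntegral.integral_symm]
        rw [← abs_of_nonneg (intervalIntegral.integral_nonneg hy.1 fun t _ => h0 (-t)), hsymm,
          abs_neg]
        exact h (-y) (Set.Icc_subset_uIcc' ⟨by linarith [hy.2], by linarith [hy.1]⟩)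
    rw [abs_of_nonpos (sub_nonpos.2 hxa)]
    simpa only [neg_neg, neg_sub_neg, neg_sub] using key

variable {F : Type*} [NormedAddCommGroup F] [NormedSpace ℝ F]

theorem norm_le_of_sub_eq_integral {Z f : ℝ → F} (hZ : Continuous Z) {a x C M : ℝ} (hC : 0 ≤ C)
    (hM : 0 ≤ M) (hint : ∀ y ∈ Set.uIcc a x, Z y - Z a = ∫ s in a..y, f s)
    (hf : ∀ s ∈ Set.uIcc a x, ‖f s‖ ≤ C + M * ‖Z s‖) :
    ‖Z x‖ ≤ (‖Z a‖ + C * |x - a|) * Real.exp (M * |x - a|) := by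
  refine le_mul_exp_of_le_add_abs_integral hZ.norm (fun _ => norm_nonneg _) hM fun y hy => ?_
  have hcont : Continuous fun s => M * ‖Z s‖ := continuous_const.mul hZ.norm
  have hnorm : ‖Z y - Z a‖ ≤ |∫ s in a..y, (C + M * ‖Z s‖)| := by
    rw [hint y hy]
    refine intervalIntegral.norm_integral_le_abs_of_norm_le
      (ae_restrict_of_forall_mem measurableSet_uIoc fun s hs => hf s ?_)
      ((continuous_const.add hcont).intervalIntegrable _ _)
    exact Set.uIcc_subset_uIcc_left hy (Set.uIoc_subset_uIcc hs)
  have hsplit : ∫ s in a..y, (C + M * ‖Z s‖) = (y - a) * C + M * ∫ s in a..y, ‖Z s‖ := by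
    rw [intervalIntegral.integral_add intervalIntegrable_const (hcont.intervalIntegrable _ _),
      intervalIntegral.integral_const, intervalIntegral.integral_const_mul, smul_eq_mul]
  calc ‖Z y‖ ≤ ‖Z a‖ + ‖Z y - Z a‖ := norm_le_norm_add_norm_sub' _ _
    _ ≤ ‖Z a‖ + (|(y - a) * C| + |M * ∫ s in a..y, ‖Z s‖|) := by
        gcongr
        exact hnorm.trans (hsplit ▸ abs_add_le _ _)
    _ = ‖Z a‖ + C * |y - a| + M * |∫ s in a..y, ‖Z s‖| := by
        rw [abs_mul, abs_mul, abs_of_nonneg hC, abs_of_nonneg hM]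
        ring
    _ ≤ ‖Z a‖ + C * |x - a| + M * |∫ s in a..y, ‖Z s‖| := by
        gcongr _ + _ * ?_ + _
        exact Set.abs_sub_left_of_mem_uIcc hy

/-- A solution of the linear differential equation `Y' = B Y` in the sense of Carathéodory: the
equation is imposed in integrated form, so `B` need not be continuous. -/
structure IsCaratheodorySolution (B : ℝ → F →L[ℝ] F) (Y : ℝ → F) : Prop where
  continuous : Continuous Y
  intervalIntegrable : ∀ a b, IntervalIntegrable (fun s => B s (Y s)) volume a b
  sub_eq_integral : ∀ a b, Y b - Y a = ∫ s in a..b, B s (Y s)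

namespace IsCaratheodorySolution

variable {B B' : ℝ → F →L[ℝ] F} {Y Y' : ℝ → F} {M δ : ℝ}

theorem comp_add_right (hY : IsCaratheodorySolution B Y) (c : ℝ) :
    IsCaratheodorySolution (fun t => B (t + c)) fun t => Y (t + c) where
  continuous := hY.continuous.comp (continuous_add_const c)
  intervalIntegrable a b := by
    simpa using (hY.intervalIntegrable (a + c) (b + c)).comp_add_right c
  sub_eq_integral a b := by
    rw [hY.sub_eq_integral, intervalIntegral.integral_comp_add_right fun s => B s (Y s)]

theorem add (hY : IsCaratheodorySolution B Y) (hY' : IsCaratheodorySolution B Y') :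
    IsCaratheodorySolution B fun t => Y t + Y' t where
  continuous := hY.continuous.add hY'.continuous
  intervalIntegrable a b := by
    simpa using (hY.intervalIntegrable a b).add (hY'.intervalIntegrable a b)
  sub_eq_integral a b := by
    simp only [map_add]
    rw [intervalIntegral.integral_add (hY.intervalIntegrable a b) (hY'.intervalIntegrable a b),
      ← hY.sub_eq_integral, ← hY'.sub_eq_integral, add_sub_add_comm]

theorem const_smul (hY : IsCaratheodorySolution B Y) (c : ℝ) :
    IsCaratheodorySolution B fun t => c • Y t where
  continuous := hY.continuous.const_smul c
  intervalIntegrable a b := by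
    simp only [map_smul]
    exact (hY.intervalIntegrable a b).smul c
  sub_eq_integral a b := by
    simp only [map_smul]
    rw [intervalIntegral.integral_smul, ← hY.sub_eq_integral, smul_sub]

theorem norm_le (hY : IsCaratheodorySolution B Y) (hM : ∀ t, ‖B t‖ ≤ M) (a x : ℝ) :
    ‖Y x‖ ≤ ‖Y a‖ * Real.exp (M * |x - a|) := by
  simpa using norm_le_of_sub_eq_integral hY.continuous le_rfl ((norm_nonneg _).trans (hM 0))
    (fun y _ => hY.sub_eq_integral a y) fun s (_ : s ∈ Set.uIcc a x) => by
      simpa using (B s).le_of_opNorm_le (hM s) _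

theorem norm_sub_le (hY : IsCaratheodorySolution B Y) (hY' : IsCaratheodorySolution B' Y')
    (hM : ∀ t, ‖B t‖ ≤ M) (hM' : ∀ t, ‖B' t‖ ≤ M) (hδ : ∀ t, ‖B t - B' t‖ ≤ δ) {a : ℝ}
    (h : Y a = Y' a) (x : ℝ) :
    ‖Y x - Y' x‖ ≤ δ * |x - a| * ‖Y a‖ * Real.exp (2 * M * |x - a|) := by
  have hM0 : 0 ≤ M := (norm_nonneg _).trans (hM 0)
  have hδ0 : 0 ≤ δ := (norm_nonneg _).trans (hδ 0)
  have hsub : ∀ y ∈ Set.uIcc a x,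
      Y y - Y' y - (Y a - Y' a) = ∫ s in a..y, (B s (Y s) - B' s (Y' s)) := by
    intro y _
    rw [intervalIntegral.integral_sub (hY.intervalIntegrable a y) (hY'.intervalIntegrable a y),
      ← hY.sub_eq_integral, ← hY'.sub_eq_integral]
    abel
  have hpointwise : ∀ s ∈ Set.uIcc a x, ‖B s (Y s) - B' s (Y' s)‖ ≤
      δ * (‖Y a‖ * Real.exp (M * |x - a|)) + M * ‖Y s - Y' s‖ := by
    intro s hs
    have hsx : |s - a| ≤ |x - a| := Set.abs_sub_left_of_mem_uIcc hs
    calc ‖B s (Y s) - B' s (Y' s)‖ = ‖(B s - B' s) (Y s) + B' s (Y s - Y' s)‖ := by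
          rw [sub_apply, map_sub, sub_add_sub_cancel]
      _ ≤ δ * ‖Y s‖ + M * ‖Y s - Y' s‖ := norm_add_le_of_le
          (ContinuousLinearMap.le_of_opNorm_le _ (hδ s) _)
          (ContinuousLinearMap.le_of_opNorm_le _ (hM' s) _)
      _ ≤ _ := by
          gcongr
          exact (hY.norm_le hM a s).trans (by gcongr)
  have key := norm_le_of_sub_eq_integral (Z := fun y => Y y - Y' y)
    (hY.continuous.sub hY'.continuous) (by positivity) hM0 hsub hpointwise
  rw [h, sub_self, norm_zero, zero_add, ← h] at key
  refine key.trans_eq ?_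
  rw [two_mul, add_mul M, Real.exp_add]
  ring

theorem eq_of_eq_at (hY : IsCaratheodorySolution B Y) (hY' : IsCaratheodorySolution B Y')
    (hM : ∀ t, ‖B t‖ ≤ M) {a : ℝ} (h : Y a = Y' a) : Y = Y' := by
  ext x
  simpa [sub_eq_zero] using hY.norm_sub_le hY' hM hM (δ := 0) (by simp) h x

end IsCaratheodorySolution

section Existence

open BoundedContinuousFunction

theorem abs_integral_exp_abs_le {K : ℝ} (hK : 0 < K) (x : ℝ) :
    |∫ s in (0 : ℝ)..x, Real.exp (K * |s|)| ≤ Real.exp (K * |x|) / K := by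
  have of_nonneg {y : ℝ} (hy : 0 ≤ y) :
      |∫ s in (0 : ℝ)..y, Real.exp (K * |s|)| ≤ Real.exp (K * y) / K := by
    have habs : ∫ s in (0 : ℝ)..y, Real.exp (K * |s|) = (Real.exp (K * y) - 1) / K := by
      rw [intervalIntegral.integral_congr (g := fun s => Real.exp (K * s)) fun s hs => by
          rw [Set.uIcc_of_le hy] at hs; simp only [abs_of_nonneg hs.1],
        intervalIntegral.integral_comp_mul_left (fun s => Real.exp s) hK.ne', integral_exp,
        mul_zero, Real.exp_zero, smul_eq_mul, inv_mul_eq_div]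
    have hone : 1 ≤ Real.exp (K * y) := Real.one_le_exp (by positivity)
    rw [habs, abs_of_nonneg (div_nonneg (sub_nonneg.2 hone) hK.le)]
    gcongr
    linarith
  rcases le_total 0 x with hx | hx
  · rw [abs_of_nonneg hx]
    exact of_nonneg hx
  · have hreflect := intervalIntegral.integral_comp_neg (a := 0) (b := x)
      fun s => Real.exp (K * |s|)
    simp only [abs_neg, neg_zero] at hreflect
    rw [hreflect, intervalIntegral.integral_symm, abs_neg, abs_of_nonpos hx]
    exact of_nonneg (neg_nonneg.2 hx)

theorem norm_exp_neg_smul_integral_exp_smul_le {g : ℝ → F} {K C : ℝ} (hK : 0 < K)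
    (hg : ∀ s, ‖g s‖ ≤ C) (x : ℝ) :
    ‖Real.exp (-(K * |x|)) • ∫ s in (0 : ℝ)..x, Real.exp (K * |s|) • g s‖ ≤ C / K := by
  have hC : 0 ≤ C := (norm_nonneg _).trans (hg 0)
  have hint : ‖∫ s in (0 : ℝ)..x, Real.exp (K * |s|) • g s‖ ≤ Real.exp (K * |x|) / K * C :=
    calc _ ≤ |∫ s in (0 : ℝ)..x, Real.exp (K * |s|) * C| :=
          intervalIntegral.norm_integral_le_abs_of_norm_le
            (ae_of_all _ fun s => by
              rw [norm_smul, Real.norm_of_nonneg (Real.exp_pos _).le]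
              gcongr
              exact hg s)
            (Continuous.intervalIntegrable (by fun_prop) _ _)
      _ ≤ Real.exp (K * |x|) / K * C := by
          rw [intervalIntegral.integral_mul_const, abs_mul, abs_of_nonneg hC]
          gcongr
          exact abs_integral_exp_abs_le hK x
  rw [norm_smul, Real.norm_of_nonneg (Real.exp_pos _).le]
  calc _ ≤ Real.exp (-(K * |x|)) * (Real.exp (K * |x|) / K * C) := by gcongr
    _ = Real.exp (-(K * |x|)) * Real.exp (K * |x|) * (C / K) := by ring
    _ = C / K := by rw [← Real.exp_add, neg_add_cancel, Real.exp_zero, one_mul]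

variable {B : ℝ → F →L[ℝ] F} {M K : ℝ}

theorem intervalIntegrable_clm_apply (hB : StronglyMeasurable B) (hM : ∀ t, ‖B t‖ ≤ M) {Y : ℝ → F}
    (hY : Continuous Y) (a b : ℝ) : IntervalIntegrable (fun s => B s (Y s)) volume a b :=
  ((continuous_const.mul hY.norm).intervalIntegrable a b).mono_fun'
    (isBoundedBilinearMap_apply.continuous.comp_stronglyMeasurable
      (hB.prodMk hY.stronglyMeasurable)).aestronglyMeasurable
    (ae_of_all _ fun s => (B s).le_of_opNorm_le (hM s) _)

/-- The Picard operator of `Y' = B Y`, `Y 0 = v`, conjugated by the weight `exp (-K |x|)`. It acts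
on bounded functions on the whole line, and large `K` makes it a contraction. -/
noncomputable def weightedPicard (hB : StronglyMeasurable B) (hM : ∀ t, ‖B t‖ ≤ M) (hK : 0 < K)
    (v : F) (f : ℝ →ᵇ F) : ℝ →ᵇ F :=
  .ofNormedAddCommGroup
    (fun x => Real.exp (-(K * |x|)) • (v + ∫ s in (0 : ℝ)..x, Real.exp (K * |s|) • B s (f s)))
    (by
      have hint (a b : ℝ) :
          IntervalIntegrable (fun s => Real.exp (K * |s|) • B s (f s)) volume a b :=
        (intervalIntegrable_clm_apply hB hM f.continuous a b).continuousOn_smul (by fun_prop)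
      have := intervalIntegral.continuous_primitive hint 0
      fun_prop)
    (‖v‖ + M * ‖f‖ / K) fun x => by
      rw [smul_add]
      refine norm_add_le_of_le ?_ (norm_exp_neg_smul_integral_exp_smul_le hK
        (fun s => (B s).le_of_opNorm_le_of_le (hM s) (f.norm_coe_le_norm s)) x)
      rw [norm_smul, Real.norm_of_nonneg (Real.exp_pos _).le]
      exact mul_le_of_le_one_left (norm_nonneg _)
        (Real.exp_le_one_iff.2 (neg_nonpos.2 (by positivity)))

theorem contractingWith_weightedPicard (hB : StronglyMeasurable B) (hM : ∀ t, ‖B t‖ ≤ M)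
    (hK : 0 < K) (hMK : 2 * M ≤ K) (v : F) :
    ContractingWith (1 / 2) (weightedPicard hB hM hK v) := by
  refine ⟨by norm_num, LipschitzWith.of_dist_le_mul fun f g => ?_⟩
  rw [BoundedContinuousFunction.dist_le (by positivity)]
  intro x
  have hint (h : ℝ →ᵇ F) :
      IntervalIntegrable (fun s => Real.exp (K * |s|) • B s (h s)) volume 0 x :=
    (intervalIntegrable_clm_apply hB hM h.continuous 0 x).continuousOn_smul (by fun_prop)
  have hsub : weightedPicard hB hM hK v f x - weightedPicard hB hM hK v g x =
      Real.exp (-(K * |x|)) • ∫ s in (0 : ℝ)..x, Real.exp (K * |s|) • B s ((f - g) s) := by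
    simp only [weightedPicard, coe_ofNormedAddCommGroup, coe_sub, Pi.sub_apply, map_sub, smul_sub]
    rw [intervalIntegral.integral_sub (hint f) (hint g), ← smul_sub, add_sub_add_left_eq_sub]
  rw [dist_eq_norm, hsub, dist_eq_norm]
  refine (norm_exp_neg_smul_integral_exp_smul_le hK (fun s => (B s).le_of_opNorm_le_of_le (hM s)
    ((f - g).norm_coe_le_norm s)) x).trans ?_
  rw [div_le_iff₀ hK]
  have : 2 * M * ‖f - g‖ ≤ K * ‖f - g‖ := by gcongr
  push_cast
  linarith

theorem exists_isCaratheodorySolution_zero [CompleteSpace F] (hB : StronglyMeasurable B)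
    (hM : ∀ t, ‖B t‖ ≤ M) (v : F) : ∃ Y, IsCaratheodorySolution B Y ∧ Y 0 = v := by
  have hM0 : 0 ≤ M := (norm_nonneg _).trans (hM 0)
  set K := 2 * M + 1
  have hK : 0 < K := by positivity
  have hc := contractingWith_weightedPicard hB hM hK (by simp [K]) v
  set f := hc.fixedPoint
  set Y : ℝ → F := fun x => Real.exp (K * |x|) • f x
  have hYc : Continuous Y := by fun_prop
  have hint := intervalIntegrable_clm_apply hB hM hYc
  have hY (x : ℝ) : Y x = v + ∫ s in (0 : ℝ)..x, B s (Y s) := by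
    have hf : f x = weightedPicard hB hM hK v f x :=
      congrArg (fun h : ℝ →ᵇ F => h x) hc.fixedPoint_isFixedPt.symm
    simp only [Y, map_smul]
    rw [hf, weightedPicard, coe_ofNormedAddCommGroup, smul_smul, ← Real.exp_add, add_neg_cancel,
      Real.exp_zero, one_smul]
  refine ⟨Y, ⟨hYc, hint, fun a b => ?_⟩, by simp [hY 0]⟩
  rw [hY b, hY a, add_sub_add_left_eq_sub,
    intervalIntegral.integral_interval_sub_left (hint 0 b) (hint 0 a)]

theorem exists_isCaratheodorySolution [CompleteSpace F] (hB : StronglyMeasurable B)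
    (hM : ∀ t, ‖B t‖ ≤ M) (a : ℝ) (v : F) : ∃ Y, IsCaratheodorySolution B Y ∧ Y a = v := by
  obtain ⟨Y, hY, hY0⟩ := exists_isCaratheodorySolution_zero (B := fun t => B (t + a))
    (hB.comp_measurable (measurable_add_const a)) (fun t => hM _) v
  exact ⟨fun t => Y (t + -a), by simpa using hY.comp_add_right (-a), by simpa⟩

end Existence

end LinearSystems

section SchrodingerSystem

theorem l2_opNorm_single_le {n : Type*} [Fintype n] [DecidableEq n] (i j : n) (c : ℝ) :
    ‖Matrix.single i j c‖ ≤ |c| := by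
  rw [Matrix.cstar_norm_def]
  refine ContinuousLinearMap.opNorm_le_bound _ (abs_nonneg c) fun v => ?_
  have hv : Matrix.toEuclideanCLM (𝕜 := ℝ) (Matrix.single i j c) v =
      EuclideanSpace.single i (c * v j) := by
    ext k
    simp [Matrix.ofLp_toEuclideanCLM, Matrix.single_mulVec, Function.update_apply]
  rw [hv, PiLp.norm_single, norm_mul, Real.norm_eq_abs]
  gcongr
  exact PiLp.norm_apply_le v j

/-- The matrix of the first-order system `(u', u)' = (q u, u')` equivalent to `u'' = q u`. -/
def schrodingerGenerator (q : ℝ) : Matrix (Fin 2) (Fin 2) ℝ :=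
  !![0, q; 1, 0]

theorem norm_schrodingerGenerator_le (q : ℝ) : ‖schrodingerGenerator q‖ ≤ 1 + |q| := by
  have h : schrodingerGenerator q = Matrix.single 1 0 1 + Matrix.single 0 1 q := by
    ext i j
    fin_cases i <;> fin_cases j <;> simp [schrodingerGenerator]
  rw [h]
  exact norm_add_le_of_le (by simpa using l2_opNorm_single_le (1 : Fin 2) 0 1)
    (l2_opNorm_single_le _ _ _)

theorem norm_schrodingerGenerator_sub_le (q r : ℝ) :
    ‖schrodingerGenerator q - schrodingerGenerator r‖ ≤ |q - r| := by
  have h : schrodingerGenerator q - schrodingerGenerator r = Matrix.single 0 1 (q - r) := by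
    ext i j
    fin_cases i <;> fin_cases j <;> simp [schrodingerGenerator]
  rw [h]
  exact l2_opNorm_single_le _ _ _

theorem continuous_schrodingerGenerator : Continuous schrodingerGenerator := by
  unfold schrodingerGenerator
  fun_prop

/-- The coefficient field of `(u', u)' = ((W - E) u, u')`. -/
noncomputable def schrodingerField (W : ℝ → ℝ) (E t : ℝ) :
    EuclideanSpace ℝ (Fin 2) →L[ℝ] EuclideanSpace ℝ (Fin 2) :=
  Matrix.toEuclideanCLM (𝕜 := ℝ) (schrodingerGenerator (W t - E))

/-- The Cauchy data `(u', u)` in Euclidean space. -/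
noncomputable def cauchyData (u : ℝ → ℝ) (x : ℝ) : EuclideanSpace ℝ (Fin 2) :=
  !₂[deriv u x, u x]

variable {W : ℝ → ℝ} {E M : ℝ} {u : ℝ → ℝ}

@[simp]
theorem schrodingerField_apply (W : ℝ → ℝ) (E t : ℝ) (v : EuclideanSpace ℝ (Fin 2)) :
    schrodingerField W E t v = !₂[(W t - E) * v 1, v 0] := by
  ext i
  fin_cases i <;> simp [schrodingerField, schrodingerGenerator, Matrix.vecHead, Matrix.vecTail]

theorem norm_schrodingerField_le (hM : ∀ t, |W t| ≤ M) (t : ℝ) :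
    ‖schrodingerField W E t‖ ≤ 1 + M + |E| := by
  refine (norm_schrodingerGenerator_le _).trans ?_
  linarith [abs_sub (W t) E, hM t]

theorem stronglyMeasurable_schrodingerField (hW : Measurable W) :
    StronglyMeasurable (schrodingerField W E) := by
  have hc : Continuous fun q : ℝ => Matrix.toEuclideanCLM (𝕜 := ℝ) (schrodingerGenerator (q - E)) :=
    (AddMonoidHomClass.isometry_of_norm Matrix.toEuclideanCLM fun _ => rfl).continuous.comp
      (continuous_schrodingerGenerator.comp (continuous_sub_right E))
  exact hc.comp_stronglyMeasurable hW.stronglyMeasurable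

theorem norm_schrodingerField_sub_le (W W' : ℝ → ℝ) (E t : ℝ) :
    ‖schrodingerField W E t - schrodingerField W' E t‖ ≤ |W t - W' t| := by
  rw [schrodingerField, schrodingerField, ← map_sub, ← sub_sub_sub_cancel_right (W t) (W' t) E]
  exact norm_schrodingerGenerator_sub_le _ _

theorem intervalIntegral_euclideanSpace_apply {n : Type*} [Fintype n]
    {f : ℝ → EuclideanSpace ℝ n} {a b : ℝ} (hf : IntervalIntegrable f volume a b) (i : n) :
    (∫ s in a..b, f s) i = ∫ s in a..b, f s i :=
  ((EuclideanSpace.proj (𝕜 := ℝ) i).intervalIntegral_comp_comm hf).symm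

namespace IsSolution

theorem continuous_deriv {𝕜 : Type} [RCLike 𝕜] {u : ℝ → 𝕜} (hu : IsSolution W E u) :
    Continuous (deriv u) := by
  refine continuous_iff_continuousAt.2 fun x =>
    (hu.deriv_ac (x - 1) (x + 1)).continuousOn.continuousAt ?_
  rw [Set.uIcc_of_le (by linarith)]
  exact Icc_mem_nhds (by linarith) (by linarith)

theorem continuous_cauchyData (hu : IsSolution W E u) : Continuous (cauchyData u) := by
  have := hu.continuous_deriv
  have := hu.differentiable.continuous
  unfold cauchyData
  fun_prop

theorem ae_deriv_deriv_eq (hu : IsSolution W E u) :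
    ∀ᵐ x, deriv (deriv u) x = (W x - E) * u x := by
  filter_upwards [hu.equation] with x hx
  simp only [RCLike.ofReal_real_eq_id, id] at hx
  linarith

theorem isCaratheodorySolution (hu : IsSolution W E u) (hW : Measurable W)
    (hM : ∀ t, |W t| ≤ M) :
    IsCaratheodorySolution (schrodingerField W E) (cauchyData u) := by
  have hint := intervalIntegrable_clm_apply (stronglyMeasurable_schrodingerField hW)
    (norm_schrodingerField_le (E := E) hM) hu.continuous_cauchyData
  refine ⟨hu.continuous_cauchyData, hint, fun a b => ?_⟩
  have hderiv : deriv u b - deriv u a = ∫ t in a..b, (W t - E) * u t := by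
    rw [← (hu.deriv_ac a b).integral_deriv_eq_sub]
    exact intervalIntegral.integral_congr_ae (hu.ae_deriv_deriv_eq.mono fun _ h _ => h)
  have happly : u b - u a = ∫ t in a..b, deriv u t :=
    (intervalIntegral.integral_deriv_eq_sub (fun t _ => hu.differentiable t)
      (hu.continuous_deriv.intervalIntegrable _ _)).symm
  ext i
  rw [intervalIntegral_euclideanSpace_apply (hint a b)]
  fin_cases i <;> simpa [cauchyData]

end IsSolution

namespace IsCaratheodorySolution

variable {Y : ℝ → EuclideanSpace ℝ (Fin 2)}

theorem schrodingerField_sub_apply_zero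
    (hY : IsCaratheodorySolution (schrodingerField W E) Y) (a b : ℝ) :
    Y b 0 - Y a 0 = ∫ t in a..b, (W t - E) * Y t 1 := by
  rw [← PiLp.sub_apply, hY.sub_eq_integral,
    intervalIntegral_euclideanSpace_apply (hY.intervalIntegrable a b)]
  simp

theorem schrodingerField_sub_apply_one
    (hY : IsCaratheodorySolution (schrodingerField W E) Y) (a b : ℝ) :
    Y b 1 - Y a 1 = ∫ t in a..b, Y t 0 := by
  rw [← PiLp.sub_apply, hY.sub_eq_integral,
    intervalIntegral_euclideanSpace_apply (hY.intervalIntegrable a b)]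
  simp

theorem hasDerivAt_apply_one (hY : IsCaratheodorySolution (schrodingerField W E) Y) (x : ℝ) :
    HasDerivAt (fun t => Y t 1) (Y x 0) x := by
  have hc : Continuous fun t => Y t 0 := by have := hY.continuous; fun_prop
  have hprim : (fun t => Y t 1) = fun t => Y 0 1 + ∫ s in (0 : ℝ)..t, Y s 0 := by
    ext t
    rw [← hY.schrodingerField_sub_apply_one, add_sub_cancel]
  rw [hprim]
  exact (hc.integral_hasStrictDerivAt 0 x).hasDerivAt.const_add _

theorem cauchyData_apply_one (hY : IsCaratheodorySolution (schrodingerField W E) Y) :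
    cauchyData (fun t => Y t 1) = Y := by
  ext x i
  fin_cases i <;> simp [cauchyData, (hY.hasDerivAt_apply_one x).deriv]

theorem isSolution (hY : IsCaratheodorySolution (schrodingerField W E) Y) :
    IsSolution W E fun t => Y t 1 := by
  have hint (a b : ℝ) : IntervalIntegrable (fun t => (W t - E) * Y t 1) volume a b := by
    have h := hY.intervalIntegrable a b
    simp only [schrodingerField_apply] at h
    exact ⟨(EuclideanSpace.proj (𝕜 := ℝ) (0 : Fin 2)).integrable_comp h.1,
      (EuclideanSpace.proj (𝕜 := ℝ) (0 : Fin 2)).integrable_comp h.2⟩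
  have hprim (a : ℝ) :
      deriv (fun t => Y t 1) = fun x => Y a 0 + ∫ t in a..x, (W t - E) * Y t 1 := by
    ext x
    rw [(hY.hasDerivAt_apply_one x).deriv, ← hY.schrodingerField_sub_apply_zero, add_sub_cancel]
  refine ⟨fun x => (hY.hasDerivAt_apply_one x).differentiableAt, fun a b => ?_, ?_⟩
  · rw [hprim a]
    exact (contDiff_const (n := 1)).contDiffOn.absolutelyContinuousOnInterval.add
      ((hint a b).absolutelyContinuousOnInterval_intervalIntegral Set.left_mem_uIcc)
  · have hl : LocallyIntegrable (fun t => (W t - E) * Y t 1) volume := fun x =>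
      ⟨Set.Ioc (x - 1) (x + 1), Ioc_mem_nhds (by linarith) (by linarith), (hint _ _).1⟩
    filter_upwards [LocallyIntegrable.ae_hasDerivAt_integral hl] with x hx
    rw [hprim 0, ((hx 0).const_add _).deriv]
    simp only [RCLike.ofReal_real_eq_id, id]
    ring

end IsCaratheodorySolution

end SchrodingerSystem

section Green

theorem norm_toLp_fin_two_le (a b : ℝ) :
    ‖(!₂[a, b] : EuclideanSpace ℝ (Fin 2))‖ ≤ |a| + |b| := by
  rw [EuclideanSpace.norm_eq, Fin.sum_univ_two, Real.sqrt_le_left (by positivity)]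
  simp only [Matrix.cons_val_zero, Matrix.cons_val_one, Real.norm_eq_abs]
  nlinarith [mul_nonneg (abs_nonneg a) (abs_nonneg b)]

open Polynomial

variable {W : ℝ → ℝ} {E M : ℝ} {u v : ℝ → ℝ}

/-- The two integrals are kept apart because no integrability of the products is needed in this
form. -/
theorem integral_mul_deriv_deriv_sub_integral_mul_deriv_deriv {a b : ℝ}
    (hu : AbsolutelyContinuousOnInterval u a b)
    (hu' : AbsolutelyContinuousOnInterval (deriv u) a b)
    (hv : AbsolutelyContinuousOnInterval v a b)
    (hv' : AbsolutelyContinuousOnInterval (deriv v) a b) :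
    (∫ t in a..b, u t * deriv (deriv v) t) - ∫ t in a..b, v t * deriv (deriv u) t =
      (u b * deriv v b - v b * deriv u b) - (u a * deriv v a - v a * deriv u a) := by
  rw [hu.integral_mul_deriv_eq_deriv_mul hv', hv.integral_mul_deriv_eq_deriv_mul hu']
  simp only [mul_comm (deriv v _)]
  ring

namespace IsSolution

theorem absolutelyContinuousOnInterval (hu : IsSolution W E u) (a b : ℝ) :
    AbsolutelyContinuousOnInterval u a b :=
  (contDiff_one_iff_deriv.2
    ⟨hu.differentiable, hu.continuous_deriv⟩).contDiffOn.absolutelyContinuousOnInterval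

theorem wronskian_eq (hu : IsSolution W E u) (hv : IsSolution W E v) (x y : ℝ) :
    u x * deriv v x - v x * deriv u x = u y * deriv v y - v y * deriv u y := by
  have hgreen := integral_mul_deriv_deriv_sub_integral_mul_deriv_deriv
    (hu.absolutelyContinuousOnInterval y x) (hu.deriv_ac y x)
    (hv.absolutelyContinuousOnInterval y x) (hv.deriv_ac y x)
  have hcancel : ∫ t in y..x, u t * deriv (deriv v) t = ∫ t in y..x, v t * deriv (deriv u) t := by
    refine intervalIntegral.integral_congr_ae ?_
    filter_upwards [hu.ae_deriv_deriv_eq, hv.ae_deriv_deriv_eq] with t hut hvt _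
    rw [hut, hvt]
    ring
  linarith

theorem abs_boundary_terms_le (hu : IsSolution W E u) (hM : ∀ t, |W t| ≤ M) {p : ℝ[X]} {C : ℝ}
    (hp : ∀ t ∈ Set.Icc (0 : ℝ) 1, |p.eval t| ≤ 1)
    (hp'' : ∀ t ∈ Set.Icc (0 : ℝ) 1, |p.derivative.derivative.eval t| ≤ C) :
    |(p.eval 1 * deriv u 1 - u 1 * p.derivative.eval 1) -
      (p.eval 0 * deriv u 0 - u 0 * p.derivative.eval 0)| ≤
      (M + |E| + C) * ∫ t in (0 : ℝ)..1, |u t| := by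
  have hderiv (q : ℝ[X]) : deriv (fun t => q.eval t) = fun t => q.derivative.eval t :=
    funext fun _ => q.deriv
  have hpoly (q : ℝ[X]) : AbsolutelyContinuousOnInterval (fun t => q.eval t) 0 1 :=
    have hq : ContDiff ℝ 1 fun t => q.eval t :=
      contDiff_one_iff_deriv.2
        ⟨q.differentiable, by simpa only [hderiv] using q.derivative.continuous⟩
    hq.contDiffOn.absolutelyContinuousOnInterval
  have hgreen := integral_mul_deriv_deriv_sub_integral_mul_deriv_deriv (hpoly p)
    (hderiv p ▸ hpoly p.derivative) (hu.absolutelyContinuousOnInterval 0 1) (hu.deriv_ac 0 1)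
  simp only [hderiv] at hgreen
  have hbound {f : ℝ → ℝ} {K : ℝ} (hf : ∀ᵐ t, t ∈ Set.Ioc (0 : ℝ) 1 → ‖f t‖ ≤ K * |u t|) :
      |∫ t in (0 : ℝ)..1, f t| ≤ K * ∫ t in (0 : ℝ)..1, |u t| := by
    rw [← intervalIntegral.integral_const_mul]
    exact intervalIntegral.norm_integral_le_of_norm_le zero_le_one (g := fun t => K * |u t|) hf
      ((continuous_const.mul hu.differentiable.continuous.abs).intervalIntegrable _ _)
  have hpu : |∫ t in (0 : ℝ)..1, p.eval t * deriv (deriv u) t| ≤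
      (M + |E|) * ∫ t in (0 : ℝ)..1, |u t| := by
    refine hbound ?_
    filter_upwards [hu.ae_deriv_deriv_eq] with t ht hmem
    rw [ht, Real.norm_eq_abs, abs_mul, abs_mul, ← one_mul ((M + |E|) * _)]
    gcongr
    · exact hp t (Set.Ioc_subset_Icc_self hmem)
    · linarith [abs_sub (W t) E, hM t]
  have hup : |∫ t in (0 : ℝ)..1, u t * p.derivative.derivative.eval t| ≤
      C * ∫ t in (0 : ℝ)..1, |u t| := by
    refine hbound (ae_of_all _ fun t hmem => ?_)
    rw [norm_mul, mul_comm]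
    exact mul_le_mul_of_nonneg_right (hp'' t (Set.Ioc_subset_Icc_self hmem)) (abs_nonneg _)
  rw [← hgreen, add_mul]
  exact (abs_sub _ _).trans (add_le_add hpu hup)

/-- The test polynomials `1 - 3 t² + 2 t³` and `t (1 - t)²` isolate one initial value each: apart
from it, all boundary terms at `0` and `1` vanish. -/
theorem norm_cauchyData_zero_le (hu : IsSolution W E u) (hM : ∀ t, |W t| ≤ M) :
    ‖cauchyData u 0‖ ≤ (2 * (M + |E|) + 10) * ∫ t in (0 : ℝ)..1, |u t| := by
  have hderiv : |deriv u 0| ≤ (M + |E| + 6) * ∫ t in (0 : ℝ)..1, |u t| := by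
    have h := hu.abs_boundary_terms_le hM (p := 1 - 3 * X ^ 2 + 2 * X ^ 3) (C := 6)
      (fun t ht => by
        simp only [eval_add, eval_sub, eval_mul, eval_pow, eval_X, eval_one, eval_ofNat]
        have h0 : 0 ≤ (1 - t) ^ 2 * (1 + 2 * t) :=
          mul_nonneg (sq_nonneg _) (by linarith [ht.1])
        have h1 : 0 ≤ t ^ 2 * (3 - 2 * t) := mul_nonneg (sq_nonneg _) (by linarith [ht.2])
        rw [abs_le]
        constructor <;> linarith)
      (fun t ht => by
        norm_num
        rw [abs_le]
        constructor <;> linarith [ht.1, ht.2])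
    norm_num at h
    exact h
  have happly : |u 0| ≤ (M + |E| + 4) * ∫ t in (0 : ℝ)..1, |u t| := by
    have h := hu.abs_boundary_terms_le hM (p := X - 2 * X ^ 2 + X ^ 3) (C := 4)
      (fun t ht => by
        simp only [eval_add, eval_sub, eval_mul, eval_pow, eval_X, eval_ofNat]
        have h0 : 0 ≤ t * (1 - t) ^ 2 := mul_nonneg ht.1 (sq_nonneg _)
        have h1 : t * (1 - t) ^ 2 ≤ 1 := mul_le_one₀ ht.2 (sq_nonneg _)
          (pow_le_one₀ (sub_nonneg.2 ht.2) (by linarith [ht.1]))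
        rw [abs_le]
        constructor <;> linarith)
      (fun t ht => by
        norm_num
        rw [abs_le]
        constructor <;> linarith [ht.1, ht.2])
    norm_num at h
    exact h
  exact (norm_toLp_fin_two_le _ _).trans (by linarith)

end IsSolution

end Green

section TransferMatrix

open Matrix (toEuclideanCLM)

variable {W W' : ℝ → ℝ} {E M δ : ℝ} {u : ℝ → ℝ}

theorem isTransferMatrix_iff {y x : ℝ} {T : Matrix (Fin 2) (Fin 2) ℝ} :
    IsTransferMatrix W E y x T ↔ ∀ u : ℝ → ℝ, IsSolution W E u →
      toEuclideanCLM (𝕜 := ℝ) T (cauchyData u y) = cauchyData u x :=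
  forall₂_congr fun u _ => by
    rw [cauchyData, cauchyData, Matrix.toEuclideanCLM_toLp, (WithLp.toLp_injective 2).eq_iff]

theorem exists_isSolution (hW : Measurable W) (hM : ∀ t, |W t| ≤ M) (E y : ℝ)
    (v : EuclideanSpace ℝ (Fin 2)) : ∃ u : ℝ → ℝ, IsSolution W E u ∧ cauchyData u y = v := by
  obtain ⟨Y, hY, hYv⟩ := exists_isCaratheodorySolution
    (stronglyMeasurable_schrodingerField hW) (norm_schrodingerField_le (E := E) hM) y v
  exact ⟨fun t => Y t 1, hY.isSolution, by rw [hY.cauchyData_apply_one, hYv]⟩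

theorem exists_isTransferMatrix (hW : Measurable W) (hM : ∀ t, |W t| ≤ M) (E y x : ℝ) :
    ∃ T, IsTransferMatrix W E y x T := by
  choose u hu huy using fun j : Fin 2 => exists_isSolution hW hM E y (EuclideanSpace.single j 1)
  refine ⟨Matrix.of fun i j => cauchyData (u j) x i, isTransferMatrix_iff.2 fun w hw => ?_⟩
  have hcomb : (fun t => cauchyData w y 0 • cauchyData (u 0) t +
      cauchyData w y 1 • cauchyData (u 1) t) = cauchyData w := by
    refine IsCaratheodorySolution.eq_of_eq_at
      ((((hu 0).isCaratheodorySolution hW hM).const_smul _).add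
        (((hu 1).isCaratheodorySolution hW hM).const_smul _))
      (hw.isCaratheodorySolution hW hM) (norm_schrodingerField_le hM) (a := y) ?_
    ext i
    fin_cases i <;> simp [huy]
  rw [← congrFun hcomb x]
  ext i
  simp [Matrix.ofLp_toEuclideanCLM, Matrix.mulVec, dotProduct, Fin.sum_univ_two, mul_comm]

theorem transferMatrix_cauchyData (hW : Measurable W) (hM : ∀ t, |W t| ≤ M)
    (hu : IsSolution W E u) (y x : ℝ) :
    toEuclideanCLM (𝕜 := ℝ) (transferMatrix W E y x) (cauchyData u y) = cauchyData u x :=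
  isTransferMatrix_iff.1 (Classical.epsilon_spec (exists_isTransferMatrix hW hM E y x)) u hu

theorem IsTransferMatrix.eq_transferMatrix (hW : Measurable W) (hM : ∀ t, |W t| ≤ M) {y x : ℝ}
    {T : Matrix (Fin 2) (Fin 2) ℝ} (hT : IsTransferMatrix W E y x T) :
    T = transferMatrix W E y x := by
  refine EquivLike.injective (toEuclideanCLM (𝕜 := ℝ)) (ContinuousLinearMap.ext fun v => ?_)
  obtain ⟨u, hu, rfl⟩ := exists_isSolution hW hM E y v
  rw [isTransferMatrix_iff.1 hT u hu, transferMatrix_cauchyData hW hM hu]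

theorem transferMatrix_self (hW : Measurable W) (hM : ∀ t, |W t| ≤ M) (E y : ℝ) :
    transferMatrix W E y y = 1 :=
  (IsTransferMatrix.eq_transferMatrix hW hM fun _ _ => Matrix.one_mulVec _).symm

theorem transferMatrix_mul_transferMatrix (hW : Measurable W) (hM : ∀ t, |W t| ≤ M)
    (E x y z : ℝ) :
    transferMatrix W E y z * transferMatrix W E x y = transferMatrix W E x z := by
  refine IsTransferMatrix.eq_transferMatrix hW hM (isTransferMatrix_iff.2 fun u hu => ?_)
  rw [map_mul, mul_apply_eq_comp, transferMatrix_cauchyData hW hM hu,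
    transferMatrix_cauchyData hW hM hu]

theorem IsSolution.comp_add_right (hu : IsSolution W E u) (hW : Measurable W)
    (hM : ∀ t, |W t| ≤ M) (c : ℝ) : IsSolution (fun t => W (t + c)) E fun t => u (t + c) :=
  ((hu.isCaratheodorySolution hW hM).comp_add_right c).isSolution

theorem cauchyData_comp_add_right (u : ℝ → ℝ) (c x : ℝ) :
    cauchyData (fun t => u (t + c)) x = cauchyData u (x + c) := by
  rw [cauchyData, deriv_comp_add_const, cauchyData]

theorem transferMatrix_comp_add_right (hW : Measurable W) (hM : ∀ t, |W t| ≤ M) (E c y x : ℝ) :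
    transferMatrix (fun t => W (t + c)) E y x = transferMatrix W E (y + c) (x + c) := by
  refine IsTransferMatrix.eq_transferMatrix hW hM (isTransferMatrix_iff.2 fun u hu => ?_)
  have hshift := hu.comp_add_right hW hM c
  rw [← cauchyData_comp_add_right, ← cauchyData_comp_add_right]
  exact transferMatrix_cauchyData (hW.comp (measurable_add_const c)) (fun t => hM _) hshift y x

theorem norm_transferMatrix_le (hW : Measurable W) (hM : ∀ t, |W t| ≤ M) (E y x : ℝ) :
    ‖transferMatrix W E y x‖ ≤ Real.exp ((1 + M + |E|) * |x - y|) := by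
  rw [Matrix.cstar_norm_def]
  refine ContinuousLinearMap.opNorm_le_bound _ (Real.exp_pos _).le fun v => ?_
  obtain ⟨u, hu, rfl⟩ := exists_isSolution hW hM E y v
  rw [transferMatrix_cauchyData hW hM hu, mul_comm]
  exact (hu.isCaratheodorySolution hW hM).norm_le (norm_schrodingerField_le hM) y x

theorem norm_transferMatrix_sub_le (hW : Measurable W) (hW' : Measurable W')
    (hM : ∀ t, |W t| ≤ M) (hM' : ∀ t, |W' t| ≤ M) (hδ : ∀ t, |W t - W' t| ≤ δ) (E y x : ℝ) :
    ‖transferMatrix W E y x - transferMatrix W' E y x‖ ≤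
      δ * |x - y| * Real.exp (2 * (1 + M + |E|) * |x - y|) := by
  have hδ0 : 0 ≤ δ := (abs_nonneg _).trans (hδ 0)
  rw [Matrix.cstar_norm_def, map_sub]
  refine ContinuousLinearMap.opNorm_le_bound _ (by positivity) fun v => ?_
  obtain ⟨u, hu, rfl⟩ := exists_isSolution hW hM E y v
  obtain ⟨u', hu', huu'⟩ := exists_isSolution hW' hM' E y (cauchyData u y)
  rw [sub_apply, transferMatrix_cauchyData hW hM hu, ← huu',
    transferMatrix_cauchyData hW' hM' hu', huu', mul_right_comm]
  exact (hu.isCaratheodorySolution hW hM).norm_sub_le (hu'.isCaratheodorySolution hW' hM')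
    (norm_schrodingerField_le hM) (norm_schrodingerField_le hM')
    (fun t => (norm_schrodingerField_sub_le _ _ _ _).trans (hδ t)) huu'.symm x

theorem det_transferMatrix (hW : Measurable W) (hM : ∀ t, |W t| ≤ M) (E y x : ℝ) :
    (transferMatrix W E y x).det = 1 := by
  choose u hu huy using fun j : Fin 2 => exists_isSolution hW hM E y (EuclideanSpace.single j 1)
  have hcol (i j : Fin 2) : transferMatrix W E y x i j = cauchyData (u j) x i := by
    rw [← transferMatrix_cauchyData hW hM (hu j), huy, Matrix.ofLp_toEuclideanCLM]
    simp
  have hdata (i j : Fin 2) : cauchyData (u j) y i = EuclideanSpace.single j (1 : ℝ) i := by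
    rw [huy]
  have hinit : deriv (u 0) y = 1 ∧ u 0 y = 0 ∧ deriv (u 1) y = 0 ∧ u 1 y = 1 := by
    simpa [cauchyData, and_assoc] using
      And.intro (And.intro (hdata 0 0) (hdata 1 0)) (And.intro (hdata 0 1) (hdata 1 1))
  obtain ⟨h00, h10, h01, h11⟩ := hinit
  have hwronskian := (hu 1).wronskian_eq (hu 0) x y
  rw [h00, h10, h01, h11] at hwronskian
  simp only [Matrix.det_fin_two, hcol, cauchyData, Matrix.cons_val_zero, Matrix.cons_val_one]
  linarith

theorem transferMatrix_ne_zero (hW : Measurable W) (hM : ∀ t, |W t| ≤ M) (E y x : ℝ) :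
    transferMatrix W E y x ≠ 0 := fun h => by
  simpa [h] using det_transferMatrix hW hM E y x

theorem abs_log_norm_transferMatrix_sub_le (hW : Measurable W)
    (hM : ∀ t, |W t| ≤ M) (E x y z : ℝ) :
    |Real.log ‖transferMatrix W E x y‖ - Real.log ‖transferMatrix W E x z‖| ≤
      (1 + M + |E|) * |y - z| := by
  have hpos (y z : ℝ) : 0 < ‖transferMatrix W E y z‖ :=
    norm_pos_iff.2 (transferMatrix_ne_zero hW hM E y z)
  have hle (y z : ℝ) : Real.log ‖transferMatrix W E x y‖ - Real.log ‖transferMatrix W E x z‖ ≤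
      (1 + M + |E|) * |y - z| := by
    rw [sub_le_iff_le_add, ← Real.log_exp ((1 + M + |E|) * |y - z|),
      ← Real.log_mul (Real.exp_pos _).ne' (hpos x z).ne']
    refine Real.log_le_log (hpos x y) ?_
    rw [← transferMatrix_mul_transferMatrix hW hM E x z y]
    exact (norm_mul_le _ _).trans (by gcongr; exact norm_transferMatrix_le hW hM E z y)
  exact abs_sub_le_iff.2 ⟨hle y z, abs_sub_comm y z ▸ hle z y⟩

end TransferMatrix

section RealSolutions

theorem absolutelyContinuousOnInterval_comp_lipschitzWith {X Y : Type*} [PseudoMetricSpace X]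
    [PseudoMetricSpace Y] {φ : X → Y} {K : NNReal} {f : ℝ → X} {a b : ℝ} (hφ : LipschitzWith K φ)
    (hf : AbsolutelyContinuousOnInterval f a b) :
    AbsolutelyContinuousOnInterval (fun t => φ (f t)) a b := by
  unfold AbsolutelyContinuousOnInterval at hf ⊢
  refine squeeze_zero (fun _ => Finset.sum_nonneg fun _ _ => dist_nonneg) (fun I => ?_)
    (by simpa only [mul_zero] using hf.const_mul (K : ℝ))
  rw [Finset.mul_sum]
  exact Finset.sum_le_sum fun _ _ => hφ.dist_le_mul _ _

theorem ae_differentiableAt_of_absolutelyContinuousOnInterval {F : Type*} [NormedAddCommGroup F]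
    [NormedSpace ℝ F] [FiniteDimensional ℝ F] {f : ℝ → F}
    (hf : ∀ a b, AbsolutelyContinuousOnInterval f a b) : ∀ᵐ x, DifferentiableAt ℝ f x := by
  refine LocallyBoundedVariationOn.ae_differentiableAt fun a b _ _ => ?_
  exact (hf a b).boundedVariationOn.mono (Set.inter_subset_right.trans Set.Icc_subset_uIcc)

theorem IsSolution.clm_comp {𝕜 𝕜' : Type} [RCLike 𝕜] [RCLike 𝕜'] {W : ℝ → ℝ} {E : ℝ} {u : ℝ → 𝕜}
    (hu : IsSolution W E u) (l : 𝕜 →L[ℝ] 𝕜') : IsSolution W E fun t => l (u t) := by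
  have hderiv : deriv (fun t => l (u t)) = fun t => l (deriv u t) :=
    funext fun t => (l.hasFDerivAt.comp_hasDerivAt t (hu.differentiable t).hasDerivAt).deriv
  refine ⟨l.differentiable.comp hu.differentiable, fun a b => ?_, ?_⟩
  · rw [hderiv]
    exact absolutelyContinuousOnInterval_comp_lipschitzWith l.lipschitz (hu.deriv_ac a b)
  · filter_upwards [hu.equation, ae_differentiableAt_of_absolutelyContinuousOnInterval hu.deriv_ac]
      with t ht hdiff
    have hsecond : deriv (fun t => l (deriv u t)) t = l (deriv (deriv u) t) :=
      (l.hasFDerivAt.comp_hasDerivAt t hdiff.hasDerivAt).deriv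
    rw [hderiv, hsecond]
    simpa only [map_add, map_neg, map_smul, ← RCLike.real_smul_eq_coe_mul] using congrArg l ht

theorem IsSchrodingerEigenvalue.exists_real {W : ℝ → ℝ} {E : ℝ}
    (h : IsSchrodingerEigenvalue W E) :
    ∃ u : ℝ → ℝ, IsSolution W E u ∧ MemLp u 2 volume ∧ u ≠ 0 := by
  obtain ⟨u, hu, hL2, hne⟩ := h
  suffices ∃ l : ℂ →L[ℝ] ℝ, (fun t => l (u t)) ≠ 0 from
    this.imp' (fun l t => l (u t)) fun l hl => ⟨hu.clm_comp l, l.comp_memLp' hL2, hl⟩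
  by_contra! hzero
  exact hne (funext fun t => Complex.ext (congrFun (hzero Complex.reCLM) t)
    (congrFun (hzero Complex.imCLM) t))

end RealSolutions

section Decay

variable {W : ℝ → ℝ} {E M : ℝ} {u : ℝ → ℝ}

theorem tendsto_intervalIntegral_add_one_cocompact {f : ℝ → ℝ} (hf : Integrable f) :
    Tendsto (fun x => ∫ t in x..x + 1, f t) (cocompact ℝ) (𝓝 0) := by
  have hindicator (x : ℝ) :
      ∫ t in x..x + 1, f t = ∫ t, (Set.Ioc x (x + 1)).indicator f t := by
    rw [intervalIntegral.integral_of_le (by linarith), integral_indicator measurableSet_Ioc]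
  have : (cocompact ℝ).IsCountablyGenerated := by
    rw [cocompact_eq_atBot_atTop]
    infer_instance
  simp only [hindicator]
  rw [← integral_zero ℝ ℝ (μ := volume)]
  refine tendsto_integral_filter_of_dominated_convergence (fun t => ‖f t‖)
    (Eventually.of_forall fun x => hf.1.indicator measurableSet_Ioc)
    (Eventually.of_forall fun x => ae_of_all _ fun t => norm_indicator_le_norm_self _ _)
    hf.norm (ae_of_all _ fun t => tendsto_const_nhds.congr' ?_)
  filter_upwards [(isCompact_Icc (a := t - 1) (b := t)).compl_mem_cocompact] with x hx
  refine (Set.indicator_of_notMem (fun ht => hx ⟨?_, ?_⟩) f).symm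
  · linarith [ht.2]
  · exact ht.1.le

theorem intervalIntegral_abs_le_sqrt_intervalIntegral_sq (hu : Continuous u) (x : ℝ) :
    ∫ t in x..x + 1, |u t| ≤ √(∫ t in x..x + 1, u t ^ 2) := by
  have : IsProbabilityMeasure (volume.restrict (Set.Ioc x (x + 1))) := ⟨by simp⟩
  refine Real.le_sqrt_of_sq_le ?_
  simp only [intervalIntegral.integral_of_le (le_add_of_nonneg_right (zero_le_one' ℝ)),
    ← sq_abs (u _)]
  exact even_two.convexOn_pow.map_integral_le (continuous_pow 2).continuousOn isClosed_univ
    (ae_of_all _ fun _ => trivial) (hu.abs.integrableOn_Ioc) ((hu.abs.pow 2).integrableOn_Ioc)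

theorem IsSolution.norm_cauchyData_le (hu : IsSolution W E u) (hW : Measurable W)
    (hM : ∀ t, |W t| ≤ M) (x : ℝ) :
    ‖cauchyData u x‖ ≤ (2 * (M + |E|) + 10) * ∫ t in x..x + 1, |u t| := by
  have h := (hu.comp_add_right hW hM x).norm_cauchyData_zero_le fun t => hM _
  rwa [cauchyData_comp_add_right, intervalIntegral.integral_comp_add_right (fun t => |u t|),
    zero_add, add_comm 1 x] at h

theorem IsSolution.tendsto_cauchyData_cocompact (hu : IsSolution W E u) (hW : Measurable W)
    (hM : ∀ t, |W t| ≤ M) (hL2 : MemLp u 2 volume) :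
    Tendsto (cauchyData u) (cocompact ℝ) (𝓝 0) := by
  have hM0 : 0 ≤ M := (abs_nonneg _).trans (hM 0)
  have hsq := (tendsto_intervalIntegral_add_one_cocompact hL2.integrable_sq).sqrt.const_mul
    (2 * (M + |E|) + 10)
  rw [Real.sqrt_zero, mul_zero] at hsq
  refine squeeze_zero_norm (fun x => (hu.norm_cauchyData_le hW hM x).trans ?_) hsq
  gcongr
  exact intervalIntegral_abs_le_sqrt_intervalIntegral_sq hu.differentiable.continuous x

end Decay

section Holder

open scoped NNReal

theorem holderOnWith_Icc_of_Icc_of_Icc {X : Type*} [PseudoEMetricSpace X] {f : ℝ → X}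
    {a b c : ℝ} {C D r : ℝ≥0} (hab : HolderOnWith C r f (Set.Icc a b))
    (hbc : HolderOnWith D r f (Set.Icc b c)) : HolderOnWith (C + D) r f (Set.Icc a c) := by
  have of_le {x y : ℝ} (hx : x ∈ Set.Icc a c) (hy : y ∈ Set.Icc a c) (hxy : x ≤ y) :
      edist (f x) (f y) ≤ (C + D : ℝ≥0) * edist x y ^ (r : ℝ) := by
    rcases le_total y b with hyb | hby
    · exact (hab.mono_const le_self_add).edist_le ⟨hx.1, hxy.trans hyb⟩ ⟨hy.1, hyb⟩
    rcases le_total b x with hbx | hxb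
    · exact (hbc.mono_const le_add_self).edist_le ⟨hbx, hx.2⟩ ⟨hby, hy.2⟩
    have hb : b ∈ Set.uIcc x y := Set.mem_uIcc_of_le hxb hby
    have hleft : edist x b ≤ edist x y := by
      simpa only [edist_dist] using ENNReal.ofReal_le_ofReal (Real.dist_left_le_of_mem_uIcc hb)
    have hright : edist b y ≤ edist x y := by
      simpa only [edist_dist, dist_comm] using
        ENNReal.ofReal_le_ofReal (Real.dist_right_le_of_mem_uIcc hb)
    calc edist (f x) (f y) ≤ edist (f x) (f b) + edist (f b) (f y) := edist_triangle _ _ _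
      _ ≤ C * edist x y ^ (r : ℝ) + D * edist x y ^ (r : ℝ) :=
        add_le_add (hab.edist_le_of_le ⟨hx.1, hxb⟩ ⟨hx.1.trans hxb, le_rfl⟩ hleft)
          (hbc.edist_le_of_le ⟨le_rfl, hby.trans hy.2⟩ ⟨hby, hy.2⟩ hright)
      _ = (C + D : ℝ≥0) * edist x y ^ (r : ℝ) := by rw [ENNReal.coe_add, add_mul]
  intro x hx y hy
  rcases le_total x y with hxy | hyx
  · exact of_le hx hy hxy
  · rw [edist_comm (f x), edist_comm x]
    exact of_le hy hx hyx

theorem holderOnWith_Icc_of_partition {X : Type*} [PseudoEMetricSpace X] {f : ℝ → X} {C r : ℝ≥0}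
    {n : ℕ} {a : Fin (n + 1) → ℝ}
    (hf : ∀ i : Fin n, HolderOnWith C r f (Set.Icc (a i.castSucc) (a i.succ))) (k : Fin (n + 1)) :
    HolderOnWith (k * C) r f (Set.Icc (a 0) (a k)) := by
  induction k using Fin.induction with
  | zero =>
    rw [Set.Icc_self]
    exact holderOnWith_singleton _ _ _ _
  | succ i ih =>
    simpa only [Fin.val_succ, Fin.val_castSucc, Nat.cast_add, Nat.cast_one, add_mul, one_mul] using
      holderOnWith_Icc_of_Icc_of_Icc ih (hf i)

theorem coe_intCast_unitAddCircle (n : ℤ) : ((n : ℝ) : UnitAddCircle) = 0 :=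
  (AddCircle.coe_eq_zero_iff 1).2 ⟨n, by simp⟩

theorem exists_coe_eq_abs_eq_norm (θ : UnitAddCircle) :
    ∃ t : ℝ, (t : UnitAddCircle) = θ ∧ |t| = ‖θ‖ ∧ |t| ≤ 1 / 2 := by
  obtain ⟨s, rfl⟩ := QuotientAddGroup.mk_surjective θ
  refine ⟨s - round s, ?_, UnitAddCircle.norm_eq.symm, abs_sub_round s⟩
  rw [AddCircle.coe_sub, coe_intCast_unitAddCircle, sub_zero]

theorem holderWith_of_holderOnWith_Icc {X : Type*} [PseudoEMetricSpace X] {f : UnitAddCircle → X}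
    {C r : ℝ≥0} (hf : HolderOnWith C r (fun t : ℝ => f t) (Set.Icc 0 1)) :
    HolderWith (3 * C) r f := by
  have hshift (n : ℤ) : HolderOnWith C r (fun t : ℝ => f t) (Set.Icc n (n + 1)) := by
    intro x hx y hy
    have h := hf (x - n) ⟨by linarith [hx.1], by linarith [hx.2]⟩ (y - n)
      ⟨by linarith [hy.1], by linarith [hy.2]⟩
    simpa [AddCircle.coe_sub, coe_intCast_unitAddCircle] using h
  have hglued : HolderOnWith (3 * C) r (fun t : ℝ => f t) (Set.Icc (-1) 2) := by
    have h := holderOnWith_Icc_of_Icc_of_Icc (holderOnWith_Icc_of_Icc_of_Icc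
      (by simpa using hshift (-1)) (by simpa using hshift 0))
      (by simpa [one_add_one_eq_two] using hshift 1)
    convert h using 1
    ring
  intro y z
  obtain ⟨s, hs, rfl⟩ := AddCircle.eq_coe_Ico y
  obtain ⟨t, ht, hnorm, hhalf⟩ := exists_coe_eq_abs_eq_norm (z - s)
  obtain rfl : ((s + t : ℝ) : UnitAddCircle) = z := by rw [AddCircle.coe_add, ht, add_sub_cancel]
  have hmem := abs_le.1 hhalf
  have h := hglued s ⟨by linarith [hs.1], by linarith [hs.2]⟩ (s + t)
    ⟨by linarith [hs.1], by linarith [hs.2]⟩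
  have hdist : edist s (s + t) = edist (s : UnitAddCircle) ((s + t : ℝ) : UnitAddCircle) := by
    rw [edist_comm, edist_comm (s : UnitAddCircle), edist_dist, edist_dist, Real.dist_eq,
      dist_eq_norm, ← hnorm, add_sub_cancel_left]
  rwa [← hdist]

theorem holderOnWith_of_dist_le {X Y : Type*} [PseudoMetricSpace X] [PseudoMetricSpace Y]
    {f : X → Y} {s : Set X} {C r : ℝ≥0}
    (h : ∀ x ∈ s, ∀ y ∈ s, dist (f x) (f y) ≤ C * dist x y ^ (r : ℝ)) : HolderOnWith C r f s := by
  intro x hx y hy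
  rw [edist_dist, edist_dist, ENNReal.ofReal_rpow_of_nonneg dist_nonneg r.coe_nonneg,
    ← ENNReal.ofReal_coe_nnreal, ← ENNReal.ofReal_mul C.coe_nonneg]
  exact ENNReal.ofReal_le_ofReal (h x hx y hy)

theorem PiecewiseHolder.exists_holderWith {γ : ℝ} {V : UnitAddCircle × UnitAddCircle → ℝ}
    (hV : PiecewiseHolder γ V) (hγ : 0 ≤ γ) :
    ∃ C, ∀ x, HolderWith C γ.toNNReal fun y => V (x, y) := by
  obtain ⟨-, n, a, -, ha0, ha1, C, hC, hholder⟩ := hV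
  lift C to ℝ≥0 using (abs_nonneg _).trans (hC 0)
  lift γ to ℝ≥0 using hγ
  rw [Real.toNNReal_coe]
  refine ⟨3 * (n * C), fun x => holderWith_of_holderOnWith_Icc ?_⟩
  have h := holderOnWith_Icc_of_partition (f := fun t : ℝ => V (x, (t : UnitAddCircle))) (a := a)
    (fun i => holderOnWith_of_dist_le (hholder x i))
    (Fin.last n)
  rwa [ha0, ha1, Fin.val_last] at h

end Holder

section MeanErgodic

variable {𝕜 E : Type*} [RCLike 𝕜] [NormedAddCommGroup E] [NormedSpace 𝕜 E]

theorem birkhoffAverage_linearMap_id_add (f : E →ₗ[𝕜] E) (n : ℕ) (x y : E) :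
    birkhoffAverage 𝕜 f id n (x + y) = birkhoffAverage 𝕜 f id n x + birkhoffAverage 𝕜 f id n y := by
  simp only [birkhoffAverage, birkhoffSum, id_eq, iterate_map_add, Finset.sum_add_distrib, smul_add]

theorem birkhoffAverage_linearMap_id_smul (f : E →ₗ[𝕜] E) (n : ℕ) (c : 𝕜) (x : E) :
    birkhoffAverage 𝕜 f id n (c • x) = c • birkhoffAverage 𝕜 f id n x := by
  simp only [birkhoffAverage, birkhoffSum, id_eq, ← Module.End.pow_apply, map_smul,
    ← Finset.smul_sum, smul_comm c]

theorem tendsto_birkhoffAverage_of_eq_smul {f : E →ₗ[𝕜] E} (hf : LipschitzWith 1 f) {z : 𝕜}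
    (hz : z ≠ 1) {x : E} (hx : f x = z • x) :
    Tendsto (birkhoffAverage 𝕜 f id · x) atTop (𝓝 0) := by
  have hbdd : Bornology.IsBounded (Set.range fun n => id (f^[n] x)) :=
    isBounded_iff_forall_norm_le.2 ⟨‖x‖, Set.forall_mem_range.2 fun n => by
      simpa [iterate_map_zero] using (hf.iterate n).dist_le_mul x 0⟩
  have h := (tendsto_birkhoffAverage_apply_sub_birkhoffAverage 𝕜 hbdd).const_smul (z - 1)⁻¹
  have hsub (y : E) : z • y - y = (z - 1) • y := by rw [sub_smul, one_smul]
  simpa only [hx, birkhoffAverage_linearMap_id_smul, hsub, inv_smul_smul₀ (sub_ne_zero.2 hz),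
    smul_zero] using h

end MeanErgodic

section Equidistribution

open AddCircle (haarAddCircle)

variable {T : ℝ} {α : AddCircle T}

/-- The Koopman operator `f ↦ f (· + α)` of the rotation by `α`. -/
noncomputable def rotationOperator (α : AddCircle T) :
    C(AddCircle T, ℂ) →ₗ[ℂ] C(AddCircle T, ℂ) :=
  (ContinuousMap.compRightAlgHom ℂ ℂ ⟨(· + α), by fun_prop⟩).toLinearMap

theorem rotationOperator_apply (α : AddCircle T) (f : C(AddCircle T, ℂ)) (θ : AddCircle T) :
    rotationOperator α f θ = f (θ + α) :=
  rfl

theorem iterate_rotationOperator_apply (α : AddCircle T) (f : C(AddCircle T, ℂ)) (n : ℕ)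
    (θ : AddCircle T) : (rotationOperator α)^[n] f θ = f (θ + n • α) := by
  induction n generalizing θ with
  | zero => simp
  | succ n ih =>
    rw [Function.iterate_succ_apply', rotationOperator_apply, ih, succ_nsmul', add_assoc]

theorem rotationOperator_fourier (α : AddCircle T) (k : ℤ) :
    rotationOperator α (fourier k) = (fourier k α : ℂ) • fourier k := by
  ext θ
  simp only [rotationOperator_apply, ContinuousMap.smul_apply, fourier_apply, smul_add,
    AddCircle.toCircle_add, Circle.coe_mul, smul_eq_mul]
  exact mul_comm _ _

variable [hT : Fact (0 < T)]

theorem lipschitzWith_rotationOperator (α : AddCircle T) : LipschitzWith 1 (rotationOperator α) :=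
  LipschitzWith.of_dist_le_mul fun f g => by
    rw [NNReal.coe_one, one_mul, ContinuousMap.dist_le dist_nonneg]
    exact fun θ => ContinuousMap.dist_apply_le_dist (θ + α)

theorem fourier_apply_ne_one (hα : ¬ IsOfFinAddOrder α) {k : ℤ} (hk : k ≠ 0) :
    (fourier k α : ℂ) ≠ 1 := fun h => by
  have hcircle : (k • α).toCircle = (0 : AddCircle T).toCircle := by
    ext
    rw [← fourier_apply, h, AddCircle.toCircle_zero, Circle.coe_one]
  exact hα (isOfFinAddOrder_iff_zsmul_eq_zero.2
    ⟨k, hk, AddCircle.injective_toCircle hT.out.ne' hcircle⟩)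

theorem tendsto_birkhoffAverage_fourier (hα : ¬ IsOfFinAddOrder α) (k : ℤ) :
    Tendsto (birkhoffAverage ℂ (rotationOperator α) id · (fourier k)) atTop
      (𝓝 ((∫ x : AddCircle T, (fourier k x : ℂ) ∂haarAddCircle) • 1)) := by
  have hmean : ∫ x : AddCircle T, (fourier k x : ℂ) ∂haarAddCircle = if k = 0 then 1 else 0 := by
    simpa [fourierCoeff, Pi.single_apply, eq_comm] using
      congrFun (fourierCoeff_fourier (T := T) k) 0
  rcases eq_or_ne k 0 with rfl | hk
  · have hone : (fourier 0 : C(AddCircle T, ℂ)) = 1 := ContinuousMap.ext fun _ => fourier_zero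
    have hfix : Function.IsFixedPt (rotationOperator α) (fourier 0) := by
      rw [Function.IsFixedPt, rotationOperator_fourier, fourier_zero, one_smul]
    rw [hmean, if_pos rfl, one_smul, ← hone]
    exact hfix.tendsto_birkhoffAverage ℂ id
  · rw [hmean, if_neg hk, zero_smul]
    exact tendsto_birkhoffAverage_of_eq_smul (lipschitzWith_rotationOperator α)
      (fourier_apply_ne_one hα hk) (rotationOperator_fourier α k)

theorem integrable_continuousMap_haarAddCircle (f : C(AddCircle T, ℂ)) :
    Integrable f haarAddCircle :=
  f.continuous.integrable_of_hasCompactSupport (.of_compactSpace _)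

theorem continuous_integral_haarAddCircle :
    Continuous fun f : C(AddCircle T, ℂ) => ∫ x, f x ∂haarAddCircle := by
  refine LipschitzWith.continuous (K := 1) (.of_dist_le_mul fun f g => ?_)
  rw [dist_eq_norm, ← integral_sub (integrable_continuousMap_haarAddCircle f)
    (integrable_continuousMap_haarAddCircle g)]
  have hle := norm_integral_le_of_norm_le_const (μ := haarAddCircle)
    (.of_forall fun x =>
      (dist_eq_norm (f x) (g x)).symm.trans_le (ContinuousMap.dist_apply_le_dist x))
  simpa using hle

theorem tendsto_birkhoffAverage_rotationOperator (hα : ¬ IsOfFinAddOrder α)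
    (f : C(AddCircle T, ℂ)) :
    Tendsto (birkhoffAverage ℂ (rotationOperator α) id · f) atTop
      (𝓝 ((∫ x, f x ∂haarAddCircle) • 1)) := by
  have hclosed := isClosed_setOfPred_tendsto_birkhoffAverage ℂ (lipschitzWith_rotationOperator α)
    uniformContinuous_id (l := fun f => (∫ x, f x ∂haarAddCircle) • 1)
    (continuous_integral_haarAddCircle.smul continuous_const)
  have hdense : f ∈
      closure (Submodule.span ℂ (Set.range (@fourier T)) : Set C(AddCircle T, ℂ)) := by
    rw [← Submodule.topologicalClosure_coe, span_fourier_closure_eq_top]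
    trivial
  refine closure_minimal (fun g hg => ?_) hclosed hdense
  rw [Set.mem_ofPred_eq]
  induction hg using Submodule.span_induction with
  | mem g hg =>
    obtain ⟨k, rfl⟩ := hg
    exact tendsto_birkhoffAverage_fourier hα k
  | zero =>
    simp [birkhoffAverage, birkhoffSum, iterate_map_zero]
  | add g h _ _ hg hh =>
    simp only [birkhoffAverage_linearMap_id_add, ContinuousMap.add_apply, add_smul,
      integral_add (integrable_continuousMap_haarAddCircle g)
        (integrable_continuousMap_haarAddCircle h)]
    exact hg.add hh
  | smul c g _ hg =>
    simp only [birkhoffAverage_linearMap_id_smul, ContinuousMap.smul_apply, integral_smul,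
      smul_assoc]
    exact hg.const_smul c

theorem eventually_sum_le_of_not_isOfFinAddOrder (hα : ¬ IsOfFinAddOrder α)
    {f : AddCircle T → ℝ} (hf : Continuous f) {ε : ℝ} (hε : 0 < ε) :
    ∀ᶠ N : ℕ in atTop, ∀ θ : AddCircle T,
      ∑ j ∈ Finset.range N, f (θ + j • α) ≤ N * ((∫ x, f x ∂haarAddCircle) + ε) := by
  have hlim := tendsto_birkhoffAverage_rotationOperator hα
    ⟨fun x => (f x : ℂ), Complex.continuous_ofReal.comp hf⟩
  filter_upwards [Metric.tendsto_nhds.1 hlim ε hε, eventually_gt_atTop 0] with N hN hpos θ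
  have hdist := (ContinuousMap.dist_apply_le_dist θ).trans_lt hN
  have hN' : (0 : ℝ) < N := Nat.cast_pos.2 hpos
  have havg : (N : ℝ)⁻¹ * ∑ j ∈ Finset.range N, f (θ + j • α) - ∫ x, f x ∂haarAddCircle ≤ ε := by
    rw [dist_eq_norm] at hdist
    refine (le_abs_self _).trans ((le_of_eq ?_).trans hdist.le)
    rw [← Real.norm_eq_abs, ← Complex.norm_real]
    simp [birkhoffAverage, birkhoffSum, iterate_rotationOperator_apply, integral_complex_ofReal]
  rw [sub_le_iff_le_add', inv_mul_le_iff₀ hN'] at havg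
  exact havg

end Equidistribution

section SubadditiveCocycle

open AddCircle (haarAddCircle)

variable {T : ℝ} {α : AddCircle T} {f : ℕ → AddCircle T → ℝ}

/-- A continuous subadditive cocycle over the rotation by `α`, the setting of Kingman's theorem. -/
structure IsSubadditiveCocycle (α : AddCircle T) (f : ℕ → AddCircle T → ℝ) : Prop where
  continuous : ∀ n, Continuous (f n)
  add_le : ∀ m n θ, f (m + n) θ ≤ f m θ + f n (θ + m • α)

namespace IsSubadditiveCocycle

theorem sub_mul (hf : IsSubadditiveCocycle α f) (c : ℝ) :
    IsSubadditiveCocycle α fun n θ => f n θ - c * n where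
  continuous n := (hf.continuous n).sub continuous_const
  add_le m n θ := by
    have := hf.add_le m n θ
    push_cast
    linarith

theorem apply_mul_le_sum (hf : IsSubadditiveCocycle α f) (n : ℕ) {N : ℕ} (hN : 1 ≤ N)
    (θ : AddCircle T) : f (n * N) θ ≤ ∑ j ∈ Finset.range N, f n (θ + j • n • α) := by
  induction N, hN using Nat.le_induction with
  | base => simp
  | succ N _ ih =>
    rw [Finset.sum_range_succ, Nat.mul_succ, ← mul_nsmul]
    exact (hf.add_le _ _ _).trans (by gcongr)

theorem apply_le_of_forall_apply_nonpos (hf : IsSubadditiveCocycle α f) {p : ℕ} (hp : 0 < p)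
    (hneg : ∀ θ, f p θ ≤ 0) {K : ℝ} (hK : ∀ r < p, ∀ θ, f r θ ≤ K) (m : ℕ) (θ : AddCircle T) :
    f m θ ≤ K := by
  induction m using Nat.strong_induction_on generalizing θ with
  | h m ih =>
    rcases lt_or_ge m p with hm | hm
    · exact hK m hm θ
    · have hsplit := hf.add_le p (m - p) θ
      rw [Nat.add_sub_cancel' hm] at hsplit
      linarith [hneg θ, ih (m - p) (by lia) (θ + p • α)]

variable [hT : Fact (0 < T)]

theorem integrable (hf : IsSubadditiveCocycle α f) (n : ℕ) : Integrable (f n) haarAddCircle :=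
  (hf.continuous n).integrable_of_hasCompactSupport (.of_compactSpace _)

theorem subadditive_integral (hf : IsSubadditiveCocycle α f) :
    Subadditive fun n => ∫ θ, f n θ ∂haarAddCircle := fun m n => by
  have hint := (hf.integrable n).comp_add_right (m • α)
  calc ∫ θ, f (m + n) θ ∂haarAddCircle
      ≤ ∫ θ, f m θ + f n (θ + m • α) ∂haarAddCircle :=
        integral_mono (hf.integrable _) ((hf.integrable m).add hint) fun θ => hf.add_le m n θ
    _ = _ := by rw [integral_add (hf.integrable m) hint, integral_add_right_eq_self (f n)]

theorem exists_forall_apply_le (hf : IsSubadditiveCocycle α f) (p : ℕ) :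
    ∃ K, ∀ r < p, ∀ θ, f r θ ≤ K := by
  have hbdd (r : ℕ) : BddAbove (Set.range (f r)) := (isCompact_range (hf.continuous r)).bddAbove
  obtain ⟨K, hK⟩ := (Set.finite_Iio p).bddAbove_biUnion.2 fun r _ => hbdd r
  exact ⟨K, fun r hr θ => hK (Set.mem_biUnion hr ⟨θ, rfl⟩)⟩

/-- By unique ergodicity the Birkhoff sums of `f n` along the rotation by `n • α` eventually become
negative everywhere, and then so do the values of `f` at all multiples of some time. -/
theorem exists_forall_le_of_integral_neg (hf : IsSubadditiveCocycle α f)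
    (hα : ¬ IsOfFinAddOrder α) {n : ℕ} (hn : 0 < n) (hneg : ∫ θ, f n θ ∂haarAddCircle < 0) :
    ∃ K, ∀ m θ, f m θ ≤ K := by
  have hnα : ¬ IsOfFinAddOrder (n • α) := fun h => hα (h.of_nsmul hn.ne')
  obtain ⟨N, hN, hNpos⟩ := ((eventually_sum_le_of_not_isOfFinAddOrder hnα (hf.continuous n)
    (neg_pos.2 hneg)).and (eventually_ge_atTop 1)).exists
  have hperiod (θ : AddCircle T) : f (n * N) θ ≤ 0 := by
    simpa using (hf.apply_mul_le_sum n hNpos θ).trans (hN θ)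
  obtain ⟨K, hK⟩ := hf.exists_forall_apply_le (n * N)
  exact ⟨K, hf.apply_le_of_forall_apply_nonpos (Nat.mul_pos hn hNpos) hperiod hK⟩

theorem exists_forall_le_add_mul (hf : IsSubadditiveCocycle α f) (hα : ¬ IsOfFinAddOrder α)
    {L L' : ℝ} (hL : Tendsto (fun n : ℕ => (∫ θ, f n θ ∂haarAddCircle) / n) atTop (𝓝 L))
    (hLL' : L < L') : ∃ K, ∀ n θ, f n θ ≤ K + L' * n := by
  obtain ⟨n, hn, hpos⟩ := ((hL.eventually_lt_const hLL').and (eventually_gt_atTop 0)).exists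
  rw [div_lt_iff₀ (Nat.cast_pos.2 hpos)] at hn
  have hneg : ∫ θ, f n θ - L' * n ∂haarAddCircle < 0 := by
    rw [integral_sub (hf.integrable n) (integrable_const _)]
    simpa using hn
  obtain ⟨K, hK⟩ := (hf.sub_mul L').exists_forall_le_of_integral_neg hα hpos hneg
  exact ⟨K, fun m θ => by linarith [hK m θ]⟩

end IsSubadditiveCocycle

end SubadditiveCocycle

section Cocycle

/-- `A n θ` is the product of the values of `A 1` at the first `n` points of the orbit of `θ` under
the translation by `α`, later points on the left. -/
structure IsCocycle {G M : Type*} [AddMonoid G] [Monoid M] (α : G) (A : ℕ → G → M) : Prop where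
  zero : ∀ θ, A 0 θ = 1
  add : ∀ m n θ, A (m + n) θ = A n (θ + m • α) * A m θ

theorem IsCocycle.sub_eq_sum {G R : Type*} [AddMonoid G] [Ring R] {α : G} {A : ℕ → G → R}
    (hA : IsCocycle α A) (k : ℕ) (θ θ' : G) :
    A k θ - A k θ' = ∑ j ∈ Finset.range k,
      A (k - 1 - j) (θ + (j + 1) • α) * (A 1 (θ + j • α) - A 1 (θ' + j • α)) * A j θ' := by
  have htelescope := Finset.sum_range_sub' (fun j => A (k - j) (θ + j • α) * A j θ') k
  simp only [Nat.sub_zero, zero_smul, add_zero, hA.zero, mul_one, Nat.sub_self, one_mul]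
    at htelescope
  rw [← htelescope]
  refine Finset.sum_congr rfl fun j hj => ?_
  have hj : j < k := Finset.mem_range.1 hj
  have hsplit : A (k - j) (θ + j • α) = A (k - 1 - j) (θ + (j + 1) • α) * A 1 (θ + j • α) := by
    rw [show k - j = 1 + (k - 1 - j) by lia, hA.add, one_smul, add_assoc, ← succ_nsmul]
  rw [hsplit, hA.add j 1 θ', show k - (j + 1) = k - 1 - j by lia]
  noncomm_ring

theorem IsCocycle.norm_sub_le {G R : Type*} [AddMonoid G] [NormedRing R] {α : G} {A : ℕ → G → R}
    (hA : IsCocycle α A) {K L δ : ℝ} (hK : ∀ n θ, ‖A n θ‖ ≤ Real.exp (K + L * n)) {θ θ' : G}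
    (hδ : ∀ j : ℕ, ‖A 1 (θ + j • α) - A 1 (θ' + j • α)‖ ≤ δ) (k : ℕ) :
    ‖A k θ - A k θ'‖ ≤ k * (δ * Real.exp (2 * K + L * (k - 1))) := by
  rw [hA.sub_eq_sum k θ θ', ← nsmul_eq_mul, ← Finset.card_range k, ← Finset.sum_const,
    Finset.card_range]
  have hδ_nonneg : 0 ≤ δ := (norm_nonneg _).trans (hδ 0)
  refine norm_sum_le_of_le _ fun j hj => ?_
  have hj : j + 1 ≤ k := Finset.mem_range.1 hj
  have hexp : Real.exp (2 * K + L * (k - 1)) =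
      Real.exp (K + L * (k - 1 - j : ℕ)) * Real.exp (K + L * j) := by
    rw [← Real.exp_add, show k - 1 - j = k - (j + 1) by lia, Nat.cast_sub hj]
    congr 1
    push_cast
    ring
  calc ‖A (k - 1 - j) (θ + (j + 1) • α) * (A 1 (θ + j • α) - A 1 (θ' + j • α)) * A j θ'‖
      ≤ ‖A (k - 1 - j) (θ + (j + 1) • α)‖ * ‖A 1 (θ + j • α) - A 1 (θ' + j • α)‖ * ‖A j θ'‖ :=
        norm_mul₃_le
    _ ≤ Real.exp (K + L * (k - 1 - j : ℕ)) * δ * Real.exp (K + L * j) := by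
        gcongr
        exacts [hK _ _, hδ j, hK _ _]
    _ = δ * Real.exp (2 * K + L * (k - 1)) := by rw [hexp]; ring

theorem IsCocycle.isSubadditiveCocycle_log_norm {T : ℝ} {R : Type*} [NormedRing R] {α : AddCircle T}
    {A : ℕ → AddCircle T → R} (hA : IsCocycle α A) (hcont : ∀ n, Continuous (A n))
    (hne : ∀ n θ, A n θ ≠ 0) : IsSubadditiveCocycle α fun n θ => Real.log ‖A n θ‖ where
  continuous n := (hcont n).norm.log fun θ => norm_ne_zero_iff.2 (hne n θ)
  add_le m n θ := by
    have hpos (n : ℕ) (θ : AddCircle T) : 0 < ‖A n θ‖ := norm_pos_iff.2 (hne n θ)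
    rw [← Real.log_mul (hpos _ _).ne' (hpos _ _).ne', mul_comm]
    refine Real.log_le_log (hpos _ _) ?_
    rw [hA.add]
    exact norm_mul_le _ _

end Cocycle

section Gordon

open Matrix (toEuclideanCLM)

theorem adjugate_fin_two_eq_trace_smul_one_sub {R : Type*} [CommRing R]
    (A : Matrix (Fin 2) (Fin 2) R) : A.adjugate = A.trace • 1 - A := by
  rw [Matrix.adjugate_fin_two, Matrix.trace_fin_two]
  ext i j
  fin_cases i <;> fin_cases j <;> simp

theorem norm_adjugate_fin_two (A : Matrix (Fin 2) (Fin 2) ℝ) : ‖A.adjugate‖ = ‖A‖ := by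
  let J : Matrix (Fin 2) (Fin 2) ℝ := !![0, 1; -1, 0]
  have hJ : J ∈ unitary (Matrix (Fin 2) (Fin 2) ℝ) := by
    rw [Unitary.mem_iff]
    constructor <;> ext i j <;> fin_cases i <;> fin_cases j <;>
      simp [J, Matrix.star_eq_conjTranspose, Matrix.mul_apply, Fin.sum_univ_two]
  have hconj : A.adjugate = J * A.conjTranspose * star J := by
    ext i j
    fin_cases i <;> fin_cases j <;>
      simp [J, Matrix.star_eq_conjTranspose, Matrix.mul_apply, Fin.sum_univ_two,
        Matrix.adjugate_fin_two, Matrix.vecMul, dotProduct]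
  rw [hconj, CStarRing.norm_mul_mem_unitary _ (Unitary.star_mem hJ),
    CStarRing.norm_mem_unitary_mul _ hJ, Matrix.l2_opNorm_conjTranspose]

theorem one_le_norm_of_det_eq_one {A : Matrix (Fin 2) (Fin 2) ℝ} (hA : A.det = 1) : 1 ≤ ‖A‖ := by
  have hsq := norm_mul_le A A.adjugate
  rw [Matrix.mul_adjugate, hA, one_smul, norm_one, norm_adjugate_fin_two] at hsq
  nlinarith [norm_nonneg A]

theorem norm_le_of_add_eq_smul {E : Type*} [SeminormedAddCommGroup E] [NormedSpace ℝ E] {t : ℝ}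
    {w v x y : E} (hv : w + x = t • v) (hx : v + y = t • x) : ‖v‖ ≤ ‖w‖ + ‖x‖ + ‖y‖ := by
  rcases le_total |t| 1 with ht | ht
  · calc ‖v‖ = ‖t • x - y‖ := by rw [← hx, add_sub_cancel_right]
      _ ≤ |t| * ‖x‖ + ‖y‖ := (norm_sub_le _ _).trans_eq (by rw [norm_smul, Real.norm_eq_abs])
      _ ≤ ‖w‖ + ‖x‖ + ‖y‖ := by nlinarith [norm_nonneg w, norm_nonneg x]
  · calc ‖v‖ ≤ |t| * ‖v‖ := le_mul_of_one_le_left (norm_nonneg v) ht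
      _ = ‖w + x‖ := by rw [hv, norm_smul, Real.norm_eq_abs]
      _ ≤ ‖w‖ + ‖x‖ + ‖y‖ := (norm_add_le w x).trans (le_add_of_nonneg_right (norm_nonneg y))

theorem norm_toEuclideanCLM_apply_le (A : Matrix (Fin 2) (Fin 2) ℝ) (v : EuclideanSpace ℝ (Fin 2)) :
    ‖toEuclideanCLM (𝕜 := ℝ) A v‖ ≤ ‖A‖ * ‖v‖ := by
  rw [Matrix.cstar_norm_def]
  exact (toEuclideanCLM (𝕜 := ℝ) A).le_opNorm v

theorem norm_le_of_det_eq_one {A : Matrix (Fin 2) (Fin 2) ℝ} (hA : A.det = 1)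
    (v : EuclideanSpace ℝ (Fin 2)) :
    ‖v‖ ≤ ‖toEuclideanCLM (𝕜 := ℝ) A.adjugate v‖ + ‖toEuclideanCLM (𝕜 := ℝ) A v‖ +
      ‖toEuclideanCLM (𝕜 := ℝ) A (toEuclideanCLM (𝕜 := ℝ) A v)‖ := by
  have htrace : A.adjugate + A = A.trace • 1 := by
    rw [adjugate_fin_two_eq_trace_smul_one_sub, sub_add_cancel]
  have hcayley : 1 + A * A = A.trace • A := by
    simpa [add_mul, Matrix.adjugate_mul, hA] using congrArg (· * A) htrace
  refine norm_le_of_add_eq_smul (t := A.trace) ?_ ?_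
  · simpa using congrArg (toEuclideanCLM (𝕜 := ℝ) · v) htrace
  · simpa using congrArg (toEuclideanCLM (𝕜 := ℝ) · v) hcayley

/-- In Gordon's argument `B'`, `A`, `B` are the transfer matrices over three consecutive blocks. -/
theorem norm_le_of_norm_sub_le_half {A B B' : Matrix (Fin 2) (Fin 2) ℝ} (hA : A.det = 1)
    (hB' : B'.det = 1) (hBA : ‖B - A‖ ≤ 1 / 2) (hB'A : ‖B' - A‖ ≤ 1 / 2)
    {w v x y : EuclideanSpace ℝ (Fin 2)} (hw : toEuclideanCLM (𝕜 := ℝ) B' w = v)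
    (hv : toEuclideanCLM (𝕜 := ℝ) A v = x) (hx : toEuclideanCLM (𝕜 := ℝ) B x = y) :
    ‖v‖ ≤ 2 * ‖w‖ + 3 * ‖x‖ + 2 * ‖y‖ := by
  have hadj : ‖(A - B').adjugate‖ ≤ 1 / 2 := by rwa [norm_adjugate_fin_two, norm_sub_rev]
  have hw_eq : toEuclideanCLM (𝕜 := ℝ) A.adjugate v =
      w + toEuclideanCLM (𝕜 := ℝ) (A - B').adjugate v := by
    have hinv : toEuclideanCLM (𝕜 := ℝ) B'.adjugate v = w := by
      rw [← hw, ← mul_apply_eq_comp, ← map_mul, Matrix.adjugate_mul, hB', one_smul, map_one]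
      rfl
    have hsub : A.adjugate = B'.adjugate + (A - B').adjugate := by
      simp only [adjugate_fin_two_eq_trace_smul_one_sub, Matrix.trace_sub, sub_smul]
      abel
    rw [hsub, map_add, add_apply, hinv]
  have hy_eq : toEuclideanCLM (𝕜 := ℝ) A x = y - toEuclideanCLM (𝕜 := ℝ) (B - A) x := by
    rw [map_sub, sub_apply, hx, sub_sub_cancel]
  have hmain := norm_le_of_det_eq_one hA v
  rw [hv, hw_eq, hy_eq] at hmain
  have hw_err : ‖toEuclideanCLM (𝕜 := ℝ) (A - B').adjugate v‖ ≤ 1 / 2 * ‖v‖ :=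
    (norm_toEuclideanCLM_apply_le _ _).trans (by gcongr)
  have hy_err : ‖toEuclideanCLM (𝕜 := ℝ) (B - A) x‖ ≤ 1 / 2 * ‖x‖ :=
    (norm_toEuclideanCLM_apply_le _ _).trans (by gcongr)
  linarith [norm_add_le w (toEuclideanCLM (𝕜 := ℝ) (A - B').adjugate v),
    norm_sub_le y (toEuclideanCLM (𝕜 := ℝ) (B - A) x)]

variable {W : ℝ → ℝ} {M E : ℝ}

theorem IsSolution.eq_zero_of_cauchyData_eq_zero {u : ℝ → ℝ} (hu : IsSolution W E u)
    (hW : Measurable W) (hM : ∀ t, |W t| ≤ M) {y : ℝ} (h : cauchyData u y = 0) : u = 0 := by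
  funext x
  have hx : cauchyData u x = 0 := by rw [← transferMatrix_cauchyData hW hM hu y x, h, map_zero]
  exact congrArg (fun v : EuclideanSpace ℝ (Fin 2) => v 1) hx

theorem not_isSchrodingerEigenvalue_of_frequently_norm_sub_le_half (hW : Measurable W)
    (hM : ∀ t, |W t| ≤ M)
    (hfreq : ∃ᶠ x : ℝ in atTop,
      ‖transferMatrix W E x (x + x) - transferMatrix W E 0 x‖ ≤ 1 / 2 ∧
        ‖transferMatrix W E (-x) 0 - transferMatrix W E 0 x‖ ≤ 1 / 2) :
    ¬ IsSchrodingerEigenvalue W E := by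
  intro hE
  obtain ⟨u, hu, hL2, hu0⟩ := hE.exists_real
  have hdecay := tendsto_norm_zero.comp (hu.tendsto_cauchyData_cocompact hW hM hL2)
  have hlim : Tendsto (fun x => 2 * ‖cauchyData u (-x)‖ + 3 * ‖cauchyData u x‖ +
      2 * ‖cauchyData u (x + x)‖) atTop (𝓝 0) := by
    have htop := hdecay.mono_left atTop_le_cocompact
    have hbot := (hdecay.mono_left atBot_le_cocompact).comp tendsto_neg_atTop_atBot
    have hdouble := htop.comp (tendsto_id.atTop_add_atTop tendsto_id)
    simpa using ((hbot.const_mul 2).add (htop.const_mul 3)).add (hdouble.const_mul 2)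
  refine hu0 (hu.eq_zero_of_cauchyData_eq_zero hW hM (y := 0) ?_)
  refine norm_le_zero_iff.1 (ge_of_tendsto_of_frequently hlim (hfreq.mono fun x hx => ?_))
  have htransfer (y z : ℝ) := transferMatrix_cauchyData hW hM hu y z
  exact norm_le_of_norm_sub_le_half (det_transferMatrix hW hM E 0 x)
    (det_transferMatrix hW hM E (-x) 0) hx.1 hx.2 (htransfer (-x) 0) (htransfer 0 x)
    (htransfer x (x + x))

end Gordon

section QuasiPeriodic

open AddCircle (haarAddCircle)
open scoped NNReal

variable {V : UnitAddCircle × UnitAddCircle → ℝ} {M : ℝ} {C r : ℝ≥0}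

theorem measurable_quasiPotential (hV : Measurable V) (ω : ℝ) (θ : UnitAddCircle) :
    Measurable (quasiPotential V ω θ) := by
  have hcoe : Measurable ((↑) : ℝ → UnitAddCircle) := AddCircle.measurable_mk'
  exact hV.comp (hcoe.prodMk ((hcoe.comp (measurable_const_mul ω)).const_add θ))

theorem quasiPotential_add_intCast (V : UnitAddCircle × UnitAddCircle → ℝ) (ω : ℝ)
    (θ : UnitAddCircle) (n : ℤ) (t : ℝ) :
    quasiPotential V ω θ (t + n) = quasiPotential V ω (θ + n • (ω : UnitAddCircle)) t := by
  have hphase : ((ω * (t + n) : ℝ) : UnitAddCircle) =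
      n • (ω : UnitAddCircle) + ((ω * t : ℝ) : UnitAddCircle) := by
    rw [← AddCircle.coe_zsmul, ← AddCircle.coe_add, zsmul_eq_mul]
    congr 1
    ring
  rw [quasiPotential, quasiPotential, hphase, AddCircle.coe_add, coe_intCast_unitAddCircle,
    add_zero, add_assoc]

theorem transferMatrix_quasiPotential_add_intCast (hV : Measurable V) (hM : ∀ p, |V p| ≤ M)
    (ω E : ℝ) (θ : UnitAddCircle) (n : ℤ) (y x : ℝ) :
    transferMatrix (quasiPotential V ω θ) E (y + n) (x + n) =
      transferMatrix (quasiPotential V ω (θ + n • (ω : UnitAddCircle))) E y x := by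
  rw [← transferMatrix_comp_add_right (measurable_quasiPotential hV ω θ) (fun _ => hM _)]
  simp only [quasiPotential_add_intCast]

theorem exists_holderWith_transferMatrix (hV : Measurable V) (hM : ∀ p, |V p| ≤ M)
    (hC : ∀ x, HolderWith C r fun y => V (x, y)) (ω E y x : ℝ) :
    ∃ D, HolderWith D r fun θ => transferMatrix (quasiPotential V ω θ) E y x := by
  let D : ℝ≥0 := Real.toNNReal |x - y| * Real.toNNReal (Real.exp (2 * (1 + M + |E|) * |x - y|))
  refine ⟨C * D, holderOnWith_univ.1 (holderOnWith_of_dist_le fun θ _ θ' _ => ?_)⟩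
  have hdist : ∀ t, |quasiPotential V ω θ t - quasiPotential V ω θ' t| ≤
      C * dist θ θ' ^ (r : ℝ) := fun t => by
    simpa only [quasiPotential, Real.dist_eq, dist_add_right] using
      (hC t).dist_le (θ + ((ω * t : ℝ) : UnitAddCircle)) (θ' + ((ω * t : ℝ) : UnitAddCircle))
  rw [dist_eq_norm]
  refine (norm_transferMatrix_sub_le (measurable_quasiPotential hV ω θ)
    (measurable_quasiPotential hV ω θ') (fun _ => hM _) (fun _ => hM _) hdist E y x).trans_eq ?_
  simp only [D, NNReal.coe_mul, Real.coe_toNNReal _ (abs_nonneg _),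
    Real.coe_toNNReal _ (Real.exp_pos _).le]
  ring

theorem isCocycle_transferMatrix (hV : Measurable V) (hM : ∀ p, |V p| ≤ M) (ω E : ℝ) :
    IsCocycle (ω : UnitAddCircle) fun (n : ℕ) θ =>
      transferMatrix (quasiPotential V ω θ) E 0 n where
  zero θ := by
    rw [Nat.cast_zero]
    exact transferMatrix_self (measurable_quasiPotential hV ω θ) (fun _ => hM _) E 0
  add m n θ := by
    have hshift := transferMatrix_quasiPotential_add_intCast hV hM ω E θ m 0 n
    rw [zero_add, Int.cast_natCast, natCast_zsmul] at hshift
    rw [← hshift, Nat.cast_add, add_comm (m : ℝ),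
      transferMatrix_mul_transferMatrix (measurable_quasiPotential hV ω θ) (fun _ => hM _)]

theorem tendsto_one_div_mul_of_tendsto_div_natCast {F : ℝ → ℝ} {K L : ℝ}
    (hF : ∀ x, 0 ≤ x → |F x - F ⌊x⌋₊| ≤ K)
    (hL : Tendsto (fun n : ℕ => F n / n) atTop (𝓝 L)) :
    Tendsto (fun x => 1 / x * F x) atTop (𝓝 L) := by
  have hfloor : Tendsto (fun x : ℝ => F ⌊x⌋₊ / (⌊x⌋₊ : ℝ) * ((⌊x⌋₊ : ℝ) / x)) atTop (𝓝 (L * 1)) :=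
    (hL.comp (tendsto_nat_floor_atTop (α := ℝ))).mul tendsto_nat_floor_div_atTop
  have hremainder : Tendsto (fun x : ℝ => (F x - F ⌊x⌋₊) / x) atTop (𝓝 0) := by
    refine squeeze_zero_norm' (a := fun x : ℝ => K / x) ?_
      (tendsto_const_nhds.div_atTop tendsto_id)
    filter_upwards [eventually_gt_atTop 0] with x hx
    rw [norm_div, Real.norm_of_nonneg hx.le]
    gcongr
    exact hF x hx.le
  have hsum := hfloor.add hremainder
  rw [mul_one, add_zero] at hsum
  refine hsum.congr' ?_
  filter_upwards [eventually_ge_atTop 1] with x hx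
  have hfloor_pos : (0 : ℝ) < ⌊x⌋₊ := Nat.cast_pos.2 (Nat.floor_pos.2 hx)
  field_simp
  ring

theorem continuous_transferMatrix_quasiPotential (hV : Measurable V) (hM : ∀ p, |V p| ≤ M)
    (hC : ∀ x, HolderWith C r fun y => V (x, y)) (hr : 0 < r) (ω E y x : ℝ) :
    Continuous fun θ => transferMatrix (quasiPotential V ω θ) E y x :=
  let ⟨_, hD⟩ := exists_holderWith_transferMatrix hV hM hC ω E y x
  hD.continuous hr

theorem isSubadditiveCocycle_log_norm_transferMatrix (hV : Measurable V) (hM : ∀ p, |V p| ≤ M)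
    (hC : ∀ x, HolderWith C r fun y => V (x, y)) (hr : 0 < r) (ω E : ℝ) :
    IsSubadditiveCocycle (ω : UnitAddCircle) fun (n : ℕ) θ =>
      Real.log ‖transferMatrix (quasiPotential V ω θ) E 0 n‖ :=
  (isCocycle_transferMatrix hV hM ω E).isSubadditiveCocycle_log_norm
    (fun n => continuous_transferMatrix_quasiPotential hV hM hC hr ω E 0 n)
    fun n θ => transferMatrix_ne_zero (measurable_quasiPotential hV ω θ) (fun _ => hM _) E 0 n

theorem integral_haarAddCircle_unitAddCircle (f : UnitAddCircle → ℝ) :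
    ∫ θ, f θ ∂haarAddCircle = ∫ θ, f θ := by
  simp [AddCircle.integral_haarAddCircle]

theorem tendsto_lyapunovExponent (hV : Measurable V) (hM : ∀ p, |V p| ≤ M)
    (hC : ∀ x, HolderWith C r fun y => V (x, y)) (hr : 0 < r) (ω E : ℝ) :
    Tendsto (fun n : ℕ => (∫ θ : UnitAddCircle,
        Real.log ‖transferMatrix (quasiPotential V ω θ) E 0 n‖ ∂haarAddCircle) / n)
      atTop (𝓝 (lyapunovExponent V ω E)) := by
  have hmeas := measurable_quasiPotential hV ω
  let F : ℝ → ℝ := fun x => ∫ θ : UnitAddCircle,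
    Real.log ‖transferMatrix (quasiPotential V ω θ) E 0 x‖ ∂haarAddCircle
  have hint (x : ℝ) : Integrable (fun θ : UnitAddCircle =>
      Real.log ‖transferMatrix (quasiPotential V ω θ) E 0 x‖) haarAddCircle :=
    ((continuous_transferMatrix_quasiPotential hV hM hC hr ω E 0 x).norm.log fun θ =>
      norm_ne_zero_iff.2 (transferMatrix_ne_zero (hmeas θ) (fun _ => hM _) E 0 x))
      |>.integrable_of_hasCompactSupport (.of_compactSpace _)
  have hfloor (x : ℝ) (hx : 0 ≤ x) : |F x - F ⌊x⌋₊| ≤ 1 + M + |E| := by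
    have hM_nonneg : 0 ≤ M := (abs_nonneg _).trans (hM 0)
    have hfract : |x - ⌊x⌋₊| ≤ 1 :=
      abs_le.2 ⟨by linarith [Nat.floor_le hx], by linarith [Nat.lt_floor_add_one x]⟩
    rw [← integral_sub (hint x) (hint _)]
    have hdiff (θ : UnitAddCircle) : ‖Real.log ‖transferMatrix (quasiPotential V ω θ) E 0 x‖ -
        Real.log ‖transferMatrix (quasiPotential V ω θ) E 0 ⌊x⌋₊‖‖ ≤ 1 + M + |E| :=
      (abs_log_norm_transferMatrix_sub_le (hmeas θ) (fun _ => hM _) E 0 x ⌊x⌋₊).trans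
        (mul_le_of_le_one_right (by positivity) hfract)
    simpa using norm_integral_le_of_norm_le_const (μ := haarAddCircle) (.of_forall hdiff)
  have hnonneg (n : ℕ) : 0 ≤ F n / n :=
    div_nonneg (integral_nonneg fun θ => Real.log_nonneg
      (one_le_norm_of_det_eq_one (det_transferMatrix (hmeas θ) (fun _ => hM _) E 0 n)))
      n.cast_nonneg
  have hlim := (isSubadditiveCocycle_log_norm_transferMatrix hV hM hC hr ω E).subadditive_integral
    |>.tendsto_lim ⟨0, Set.forall_mem_range.2 hnonneg⟩
  have hlyap := (tendsto_one_div_mul_of_tendsto_div_natCast hfloor hlim).limUnder_eq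
  simp only [lyapunovExponent, ← integral_haarAddCircle_unitAddCircle]
  exact hlyap ▸ hlim

end QuasiPeriodic

section Liouville

open AddCircle (haarAddCircle)
open scoped NNReal

theorem frequently_norm_nsmul_lt_exp {ω b : ℝ} (hω : ¬ IsOfFinAddOrder (ω : UnitAddCircle))
    (hb : (b : EReal) < liouvilleExponent ω) :
    ∃ᶠ k : ℕ in atTop, ‖k • (ω : UnitAddCircle)‖ < Real.exp (-(b * k)) := by
  refine ((frequently_lt_of_lt_limsup (h := hb)).and_eventually
    (eventually_gt_atTop 0)).mono fun k ⟨hk, hk_pos⟩ => ?_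
  have hnorm_pos : 0 < ‖k • (ω : UnitAddCircle)‖ := norm_pos_iff.2 fun h =>
    hω (isOfFinAddOrder_iff_nsmul_eq_zero.2 ⟨k, hk_pos, h⟩)
  rw [← nsmul_eq_mul, AddCircle.coe_nsmul, ENNReal.log_ofReal_of_pos hnorm_pos, ← EReal.coe_neg,
    ← EReal.coe_div, EReal.coe_lt_coe_iff, lt_div_iff₀ (Nat.cast_pos.2 hk_pos)] at hk
  exact (Real.log_lt_iff_lt_exp hnorm_pos).1 (lt_neg_of_lt_neg hk)

theorem exists_real_btwn_of_lt_mul {L γ : ℝ} (hγ : 0 < γ) {β : EReal}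
    (h : (L : EReal) < (γ : EReal) * β) : ∃ b : ℝ, L < γ * b ∧ (b : EReal) < β := by
  have hdiv : ((L / γ : ℝ) : EReal) < β := by
    rw [EReal.coe_div]
    exact (EReal.div_lt_iff (EReal.coe_pos.2 hγ) (EReal.coe_ne_top γ)).2 (by rwa [mul_comm])
  obtain ⟨b, hLb, hb⟩ := EReal.lt_iff_exists_real_btwn.1 hdiv
  rw [EReal.coe_lt_coe_iff, div_lt_iff₀' hγ] at hLb
  exact ⟨b, hLb, hb⟩

theorem IsCocycle.dist_le_of_holderWith {G R : Type*} [SeminormedAddCommGroup G] [NormedRing R]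
    {α : G} {A : ℕ → G → R} (hA : IsCocycle α A) {K L b : ℝ}
    (hK : ∀ n θ, ‖A n θ‖ ≤ Real.exp (K + L * n)) {C r : ℝ≥0} (hC : HolderWith C r (A 1)) {k : ℕ}
    {θ θ' : G} (hθ : dist θ θ' ≤ Real.exp (-(b * k))) :
    dist (A k θ) (A k θ') ≤
      C * Real.exp (2 * K - L) * (k * Real.exp (-(r * b - L) * k)) := by
  have hstep (j : ℕ) : ‖A 1 (θ + j • α) - A 1 (θ' + j • α)‖ ≤ C * Real.exp (-(r * b * k)) := by
    rw [← dist_eq_norm]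
    refine (hC.dist_le _ _).trans ?_
    rw [dist_add_right, show -(r * b * k) = -(b * k) * (r : ℝ) by ring, Real.exp_mul]
    gcongr
  have hexp : Real.exp (-(r * b * k)) * Real.exp (2 * K + L * (k - 1)) =
      Real.exp (2 * K - L) * Real.exp (-(r * b - L) * k) := by
    rw [← Real.exp_add, ← Real.exp_add]
    ring_nf
  calc dist (A k θ) (A k θ')
      ≤ k * (C * Real.exp (-(r * b * k)) * Real.exp (2 * K + L * (k - 1))) := by
        rw [dist_eq_norm]
        exact hA.norm_sub_le hK hstep k
    _ = C * Real.exp (2 * K - L) * (k * Real.exp (-(r * b - L) * k)) := by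
        rw [mul_assoc (C : ℝ), hexp]
        ring

theorem IsCocycle.frequently_dist_le {R : Type*} [NormedRing R] {A : ℕ → UnitAddCircle → R}
    {ω b L ε : ℝ} {C r : ℝ≥0} (hA : IsCocycle (ω : UnitAddCircle) A)
    (hcont : ∀ n, Continuous (A n)) (hne : ∀ n θ, A n θ ≠ 0) (hC : HolderWith C r (A 1))
    (hL : Tendsto (fun n : ℕ => (∫ θ, Real.log ‖A n θ‖ ∂haarAddCircle) / n) atTop (𝓝 L))
    (hLb : L < r * b) (hb : (b : EReal) < liouvilleExponent ω) (hε : 0 < ε) :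
    ∃ᶠ k : ℕ in atTop, ∀ θ θ', dist θ θ' = ‖k • (ω : UnitAddCircle)‖ →
      dist (A k θ) (A k θ') ≤ ε := by
  by_cases hω : IsOfFinAddOrder (ω : UnitAddCircle)
  · obtain ⟨N, hN, hNω⟩ := isOfFinAddOrder_iff_nsmul_eq_zero.1 hω
    refine frequently_atTop.2 fun a => ⟨a * N, Nat.le_mul_of_pos_right a hN, fun θ θ' h => ?_⟩
    rw [mul_smul, hNω, smul_zero, norm_zero, dist_eq_zero] at h
    rw [h, dist_self]
    exact hε.le
  obtain ⟨L', hLL', hL'b⟩ := exists_between hLb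
  obtain ⟨K, hK⟩ :=
    (hA.isSubadditiveCocycle_log_norm hcont hne).exists_forall_le_add_mul hω hL hLL'
  have hgrowth (n : ℕ) (θ : UnitAddCircle) : ‖A n θ‖ ≤ Real.exp (K + L' * n) :=
    (Real.log_le_iff_le_exp (norm_pos_iff.2 (hne n θ))).1 (hK n θ)
  have hsmall : Tendsto (fun k : ℕ =>
      C * Real.exp (2 * K - L') * (k * Real.exp (-(r * b - L') * k))) atTop (𝓝 0) := by
    simpa using ((tendsto_rpow_mul_exp_neg_mul_atTop_nhds_zero 1 (r * b - L')
      (sub_pos.2 hL'b)).comp tendsto_natCast_atTop_atTop).const_mul (C * Real.exp (2 * K - L'))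
  exact ((frequently_norm_nsmul_lt_exp hω hb).and_eventually
    (hsmall.eventually_le_const hε)).mono fun k ⟨hk, hkε⟩ θ θ' hdist =>
      (hA.dist_le_of_holderWith hgrowth hC (hdist.trans_le hk.le)).trans hkε

theorem frequently_dist_transferMatrix_le {V : UnitAddCircle × UnitAddCircle → ℝ}
    {ω E γ ε : ℝ} (hγ : 0 < γ) (hV : PiecewiseHolder γ V)
    (hE : (lyapunovExponent V ω E : EReal) < (γ : EReal) * liouvilleExponent ω) (hε : 0 < ε) :
    ∃ᶠ k : ℕ in atTop, ∀ θ θ', dist θ θ' = ‖k • (ω : UnitAddCircle)‖ →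
      dist (transferMatrix (quasiPotential V ω θ) E 0 k)
        (transferMatrix (quasiPotential V ω θ') E 0 k) ≤ ε := by
  obtain ⟨C, hC⟩ := hV.exists_holderWith hγ.le
  obtain ⟨hmeas, -, -, -, -, -, M, hM, -⟩ := hV
  have hγ' : 0 < γ.toNNReal := Real.toNNReal_pos.2 hγ
  obtain ⟨b, hLb, hb⟩ := exists_real_btwn_of_lt_mul hγ hE
  obtain ⟨D, hD⟩ := exists_holderWith_transferMatrix hmeas hM hC ω E 0 1
  refine (isCocycle_transferMatrix hmeas hM ω E).frequently_dist_le
    (fun n => continuous_transferMatrix_quasiPotential hmeas hM hC hγ' ω E 0 n)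
    (fun n θ => transferMatrix_ne_zero (measurable_quasiPotential hmeas ω θ) (fun _ => hM _) E 0 n)
    (by simpa using hD) (tendsto_lyapunovExponent hmeas hM hC hγ' ω E) ?_ hb hε
  rwa [Real.coe_toNNReal γ hγ.le]

end Liouville

theorem mainTheorem1_general (γ : ℝ) (hγ : 0 < γ) (ω : ℝ)
    (V : UnitAddCircle × UnitAddCircle → ℝ) (hV : PiecewiseHolder γ V) (E : ℝ)
    (hE : (lyapunovExponent V ω E : EReal) < (γ : EReal) * liouvilleExponent ω)
    (θ : UnitAddCircle) : ¬ IsSchrodingerEigenvalue (quasiPotential V ω θ) E := by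
  have hclose := frequently_dist_transferMatrix_le hγ hV hE one_half_pos
  obtain ⟨hmeas, -, -, -, -, -, M, hM, -⟩ := hV
  refine not_isSchrodingerEigenvalue_of_frequently_norm_sub_le_half
    (measurable_quasiPotential hmeas ω θ) (fun _ => hM _)
    (tendsto_natCast_atTop_atTop.frequently (hclose.mono fun k hk => ?_))
  have hnext := transferMatrix_quasiPotential_add_intCast hmeas hM ω E θ k 0 k
  have hprev := transferMatrix_quasiPotential_add_intCast hmeas hM ω E θ (-k) 0 k
  simp only [zero_add, Int.cast_natCast, natCast_zsmul, Int.cast_neg, add_neg_cancel, neg_smul]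
    at hnext hprev
  rw [hnext, hprev, ← dist_eq_norm, ← dist_eq_norm]
  exact ⟨hk _ _ (by simp), hk _ _ (by simp)⟩

theorem mainTheorem1 (γ : ℝ) (hγ : 0 < γ) (ω : ℝ) (V : UnitAddCircle × UnitAddCircle → ℝ)
    (hV : PiecewiseHolder γ V) (E : ℝ)
    (hE : (lyapunovExponent V ω E : EReal) < (γ : EReal) * liouvilleExponent ω) :
    ¬ IsSchrodingerEigenvalue (quasiPotential V ω 0) E :=
  mainTheorem1_general γ hγ ω V hV E hE 0
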